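/- **Setting.** Let $g$ be a smooth metric of signature $(-,+,+,+)$ on a coordinate domain $U\subseteq\mathbb R^4$ (arbitrary coordinates), with Levi-Civita connection $\nabla$ and Riemann tensor $R^\rho{}_{\sigma\mu\nu}=\partial_\mu\Gamma^\rho_{\nu\sigma}-\partial_\nu\Gamma^\rho_{\mu\sigma}+\Gamma^\rho_{\mu\kappa}\Gamma^\kappa_{\nu\sigma}-\Gamma^\rho_{\nu\kappa}\Gamma^\kappa_{\mu\sigma}$. Let $t$ be a smooth function on $U$ with timelike gradient, whose level sets are the slices $\Sigma_t$. Put $\alpha=(-g^{\mu\nu}\partial_\mu t\,\partial_\nu t)^{-1/2}$ (lapse), $n_\mu=-\alpha\,\partial_\mu t$ (unit normal), $\gamma_{\mu\nu}=g_{\mu\nu}+n_\mu n_\nu$ (induced metric), $K_{\mu\nu}=-\gamma^\sigma{}_\mu\gamma^\rho{}_\nu\nabla_\sigma n_\rho$ (extrinsic curvature). Let $D$ be the spatial covariant derivative, that is $\nabla$ with all indices projected by $\gamma^\mu{}_\nu$, and let ${}^{(3)}R_{\mu\alpha\beta\nu}$ be the Riemann tensor of the metric induced on the slices, regarded as a spatial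 spacetime tensor. Let $\lambda\mapsto x(\lambda)\in U$ be an affinely parametrized null geodesic on an open interval, with tangent $\ell^\mu$, and let $\phi^\mu_{\boldsymbol\alpha}=(u^\mu,\phi^\mu_{\mathbf 1},\phi^\mu_{\mathbf 2},\ell^\mu)$ be parallel transported along it. Suppose that at one point of the geodesic it is a semi-null frame: $u^\mu u_\mu=-1$, $\ell^\mu\ell_\mu=0$, $u^\mu\ell_\mu=Q\neq0$, and $\phi_{\mathbf 1},\phi_{\mathbf 2}$ are orthonormal and orthogonal to $u$ and $\ell$. Write $$\ell^\mu=\mathcal S(n^\mu+V^\mu),\quad \mathcal S=-n_\mu\ell^\mu,\ n_\mu V^\mu=0,\qquad \phi^\mu_{\boldsymbol\alpha}=\Phi_{\boldsymbol\alpha}n^\mu+F^\mu_{\boldsymbol\alpha},\quad \Phi_{\boldsymbol\alpha}=-n_\sigma\phi^\sigma_{\boldsymbol\alpha},\ F^\mu_{\boldsymbol\alpha}=\gamma^\mu{}_\sigma\phi^\sigma_{\boldsymbol\alpha}.$$ The optical tidal matrix in the frame is $R^{\boldsymbol\mu}{}_{\ell\ell\boldsymbol\nu}=h^{\boldsymbol\mu\boldsymbol\omega}R_{\rho\alpha\beta\sigma}\phi^\rho_{\boldsymbol\omega}\ell^\alpha\ell^\beta\phi^\sigma_{\boldsymbol\nu}$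 with $$h^{\boldsymbol\mu\boldsymbol\omega}=\begin{pmatrix}0&0&0&\frac1Q\\0&1&0&0\\0&0&1&0\\\frac1Q&0&0&\frac1{Q^2}\end{pmatrix}.$$ **Claim.** At every point of the geodesic $h^{\boldsymbol\mu\boldsymbol\omega}$ is the inverse of the frame metric $g_{\mu\nu}\phi^\mu_{\boldsymbol\alpha}\phi^\nu_{\boldsymbol\beta}$; $\mathcal S\ne0$ and the above splittings hold; $R^{\boldsymbol\mu}{}_{\ell\ell\boldsymbol\nu}$ is the matrix in the frame of the operator $R^\mu{}_{\alpha\beta\nu}\ell^\alpha\ell^\beta$; and $$\begin{aligned}R^{\boldsymbol\mu}{}_{\ell\ell\boldsymbol\nu}=\mathcal S^2h^{\boldsymbol\mu\boldsymbol\rho}\big[&\mathcal R_{\beta\alpha}\big(\Phi_{\boldsymbol\rho}F^\beta_{\boldsymbol\nu}V^\alpha+\Phi_{\boldsymbol\nu}F^\beta_{\boldsymbol\rho}V^\alpha-\Phi_{\boldsymbol\rho}\Phi_{\boldsymbol\nu}V^\beta V^\alpha-F^\alpha_{\boldsymbol\rho}F^\beta_{\boldsymbol\nu}\big)\\&+\mathcal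 C_{\sigma\beta\alpha}\big(\Phi_{\boldsymbol\rho}F^\sigma_{\boldsymbol\nu}V^\alpha V^\beta+\Phi_{\boldsymbol\nu}F^\sigma_{\boldsymbol\rho}V^\alpha V^\beta-F^\alpha_{\boldsymbol\rho}F^\sigma_{\boldsymbol\nu}V^\beta-F^\alpha_{\boldsymbol\nu}F^\sigma_{\boldsymbol\rho}V^\beta\big)\\&+\mathcal G_{\omega\alpha\beta\sigma}F^\omega_{\boldsymbol\rho}V^\alpha V^\beta F^\sigma_{\boldsymbol\nu}\big],\end{aligned}$$ where the following Gauss, Codazzi and Ricci relations hold on $U$ (the first in any smooth coordinates on the slice): $$\begin{aligned}\mathcal G_{\mu\alpha\beta\nu}&:=R_{\rho\delta\theta\sigma}\gamma^\rho{}_\mu\gamma^\delta{}_\alpha\gamma^\theta{}_\beta\gamma^\sigma{}_\nu={}^{(3)}R_{\mu\alpha\beta\nu}+K_{\mu\beta}K_{\alpha\nu}-K_{\mu\nu}K_{\beta\alpha},\\ \mathcal C_{\mu\alpha\beta}&:=R_{\rho\delta\theta\sigma}n^\rho\gamma^\delta{}_\beta\gamma^\theta{}_\alpha\gamma^\sigma{}_\mu=D_\alpha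 K_{\mu\beta}-D_\mu K_{\alpha\beta},\\ \mathcal R_{\mu\nu}&:=R_{\rho\delta\theta\sigma}n^\rho\gamma^\delta{}_\nu n^\theta\gamma^\sigma{}_\mu=\mathcal L_nK_{\mu\nu}+\tfrac1\alpha D_\nu D_\mu\alpha+K^\rho{}_\mu K_{\nu\rho}.\end{aligned}$$ Moreover, numbering the frame vectors $0,1,2,3$ in the order $(u,\phi_{\mathbf 1},\phi_{\mathbf 2},\ell)$, the components $R^{\boldsymbol 0}{}_{\ell\ell\boldsymbol\nu}$ and $R^{\boldsymbol\mu}{}_{\ell\ell\boldsymbol 3}=R^{\boldsymbol\mu}{}_{\ell\ell\ell}$ vanish for all $\boldsymbol\mu,\boldsymbol\nu$. -/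

import Mathlib

open scoped ContDiff

noncomputable section

namespace ThreePlusOne

/-! ### Pseudo-Riemannian geometry in coordinates

Points are coordinate tuples `x : Fin d → ℝ`; a metric is the matrix of its components in an
arbitrary coordinate system. Curvature conventions: signature `(-,+,+,+)` and
`R^ρ_{σμν} = ∂_μ Γ^ρ_{νσ} - ∂_ν Γ^ρ_{μσ} + Γ^ρ_{μκ} Γ^κ_{νσ} - Γ^ρ_{νκ} Γ^κ_{μσ}`. -/

/-- Coordinates of a point, or components of a vector, in dimension `d`. -/
abbrev Coord (d : ℕ) := Fin d → ℝ

/-- The component functions `g_{μν}(x)` of a metric. -/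
abbrev MetricField (d : ℕ) := Coord d → Matrix (Fin d) (Fin d) ℝ

/-- The partial derivative `∂_μ f` at `x`. -/
def pd {d : ℕ} (μ : Fin d) (f : Coord d → ℝ) (x : Coord d) : ℝ :=
  fderiv ℝ f x (Pi.single μ 1)

/-- The Christoffel symbols `Γ^μ_{αβ}` of the Levi-Civita connection of `g`. -/
def christoffel {d : ℕ} (g : MetricField d) (μ α β : Fin d) (x : Coord d) : ℝ :=
  1 / 2 * ∑ ρ, (g x)⁻¹ μ ρ *
    (pd α (fun y => g y ρ β) x + pd β (fun y => g y α ρ) x - pd ρ (fun y => g y α β) x)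

/-- The Riemann tensor `R^ρ_{σμν}`. -/
def riemannUp {d : ℕ} (g : MetricField d) (ρ σ μ ν : Fin d) (x : Coord d) : ℝ :=
  pd μ (christoffel g ρ ν σ) x - pd ν (christoffel g ρ μ σ) x
    + ∑ κ, (christoffel g ρ μ κ x * christoffel g κ ν σ x
      - christoffel g ρ ν κ x * christoffel g κ μ σ x)

/-- The Riemann tensor with all indices down, `R_{ρσμν} = g_{ρκ} R^κ_{σμν}`. -/
def riemann {d : ℕ} (g : MetricField d) (ρ σ μ ν : Fin d) (x : Coord d) : ℝ :=
  ∑ κ, g x ρ κ * riemannUp g κ σ μ ν x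

/-- The covariant derivative `∇_μ θ_ν` of a one-form field `θ`. -/
def nabla₁ {d : ℕ} (g : MetricField d) (θ : Fin d → Coord d → ℝ) (μ ν : Fin d)
    (x : Coord d) : ℝ :=
  pd μ (θ ν) x - ∑ κ, christoffel g κ μ ν x * θ κ x

/-- The covariant derivative `∇_σ T_{μν}` of a covariant two-tensor field `T`. -/
def nabla₂ {d : ℕ} (g : MetricField d) (T : Fin d → Fin d → Coord d → ℝ) (σ μ ν : Fin d)
    (x : Coord d) : ℝ :=
  pd σ (T μ ν) x - ∑ κ, christoffel g κ σ μ x * T κ ν x - ∑ κ, christoffel g κ σ ν x * T μ κ x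

/-- The scalar product `g_{μν} v^μ w^ν` at `x`. -/
def scalarProd {d : ℕ} (g : MetricField d) (x v w : Coord d) : ℝ :=
  ∑ μ, ∑ ν, g x μ ν * v μ * w ν

/-- The contraction `R_{ραβσ} a^ρ b^α c^β e^σ` at `x`. -/
def riemannApply {d : ℕ} (g : MetricField d) (x a b c e : Coord d) : ℝ :=
  ∑ ρ, ∑ α, ∑ β, ∑ σ, riemann g ρ α β σ x * a ρ * b α * c β * e σ

/-- A smooth metric of signature `(-,+,+,+)` on `U`: at each point of `U` there is a basis
(the columns of `P`) in which the metric is `diag(-1,1,1,1)`. -/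
structure IsLorentzMetricOn (g : MetricField 4) (U : Set (Coord 4)) : Prop where
  smooth : ∀ μ ν, ContDiffOn ℝ ∞ (fun x => g x μ ν) U
  signature : ∀ x ∈ U, ∃ P : Matrix (Fin 4) (Fin 4) ℝ, IsUnit P.det ∧
    P.transpose * g x * P = Matrix.diagonal ![-1, 1, 1, 1]

/-! ### The foliation by the level sets of a time function -/

/-- `t` is a smooth function with timelike gradient on `U`, so that its level sets are spacelike
hypersurfaces foliating `U`. -/
structure IsTimeFunctionOn (g : MetricField 4) (t : Coord 4 → ℝ) (U : Set (Coord 4)) :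
    Prop where
  smooth : ContDiffOn ℝ ∞ t U
  timelike : ∀ x ∈ U, ∑ μ, ∑ ν, (g x)⁻¹ μ ν * pd μ t x * pd ν t x < 0

variable (g : MetricField 4) (t : Coord 4 → ℝ)

/-- The lapse `α = (-g^{μν} ∂_μ t ∂_ν t)^{-1/2}`. -/
def lapse (x : Coord 4) : ℝ :=
  (√(-∑ μ, ∑ ν, (g x)⁻¹ μ ν * pd μ t x * pd ν t x))⁻¹

/-- The unit normal one-form `n_μ = -α ∂_μ t`. -/
def normalForm (μ : Fin 4) (x : Coord 4) : ℝ := -lapse g t x * pd μ t x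

/-- The unit normal vector `n^μ`. -/
def normal (μ : Fin 4) (x : Coord 4) : ℝ := ∑ ν, (g x)⁻¹ μ ν * normalForm g t ν x

/-- The orthogonal projector `γ^μ_ν = δ^μ_ν + n^μ n_ν` onto the slices. -/
def proj (μ ν : Fin 4) (x : Coord 4) : ℝ :=
  (if μ = ν then 1 else 0) + normal g t μ x * normalForm g t ν x

/-- The extrinsic curvature `K_{μν} = -γ^σ_μ γ^ρ_ν ∇_σ n_ρ`. -/
def extrinsic (μ ν : Fin 4) (x : Coord 4) : ℝ :=
  -∑ σ, ∑ ρ, proj g t σ μ x * proj g t ρ ν x * nabla₁ g (normalForm g t) σ ρ x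

/-- The spatial covariant derivative `D_α K_{μβ}` of the extrinsic curvature. -/
def spatialDerivK (α μ β : Fin 4) (x : Coord 4) : ℝ :=
  ∑ σ, ∑ ρ, ∑ τ, proj g t σ α x * proj g t ρ μ x * proj g t τ β x *
    nabla₂ g (extrinsic g t) σ ρ τ x

/-- The spatial gradient `D_μ α` of the lapse. -/
def spatialGradLapse (μ : Fin 4) (x : Coord 4) : ℝ :=
  ∑ σ, proj g t σ μ x * pd σ (lapse g t) x

/-- The spatial Hessian `D_ν D_μ α` of the lapse. -/
def spatialHessLapse (ν μ : Fin 4) (x : Coord 4) : ℝ :=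
  ∑ σ, ∑ ρ, proj g t σ ν x * proj g t ρ μ x * nabla₁ g (spatialGradLapse g t) σ ρ x

/-- The Lie derivative `(L_n K)_{μν}` of the extrinsic curvature along the unit normal. -/
def lieNormalK (μ ν : Fin 4) (x : Coord 4) : ℝ :=
  ∑ σ, (normal g t σ x * pd σ (extrinsic g t μ ν) x
    + extrinsic g t σ ν x * pd μ (normal g t σ) x
    + extrinsic g t μ σ x * pd ν (normal g t σ) x)

/-! ### The intrinsic curvature of a slice -/

/-- `ψ`, defined on the open set `W ⊆ ℝ³`, is the inverse of a coordinate system on (a piece of)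
a level set of `t`: a smooth immersion into `U` on which `t` is constant. -/
structure IsSliceParam (t : Coord 4 → ℝ) (U : Set (Coord 4)) (W : Set (Coord 3))
    (ψ : Coord 3 → Coord 4) : Prop where
  isOpen : IsOpen W
  smooth : ContDiffOn ℝ ∞ ψ W
  mapsTo : ∀ y ∈ W, ψ y ∈ U
  immersion : ∀ y ∈ W, Function.Injective (fderiv ℝ ψ y)
  level : ∃ t₀ : ℝ, ∀ y ∈ W, t (ψ y) = t₀

/-- The induced metric `γ_{ij} = g_{μν} ∂_i ψ^μ ∂_j ψ^ν` in the slice coordinates. -/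
def sliceMetric (ψ : Coord 3 → Coord 4) : MetricField 3 := fun y =>
  Matrix.of fun i j => ∑ μ, ∑ ν, g (ψ y) μ ν *
    pd i (fun z => ψ z μ) y * pd j (fun z => ψ z ν) y

/-- The one-forms `γ^{ij} g_{μν} ∂_j ψ^ν`, which extend `dx^i` from the slice to all spacetime
vectors by zero on the normal. -/
def sliceCoframe (ψ : Coord 3 → Coord 4) (i : Fin 3) (μ : Fin 4) (y : Coord 3) : ℝ :=
  ∑ j, (sliceMetric g ψ y)⁻¹ i j * ∑ ν, g (ψ y) μ ν * pd j (fun z => ψ z ν) y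

/-- The Riemann tensor of the induced metric of the slice, as the spatial spacetime tensor
`⁽³⁾R_{μαβν}` at the point `ψ y`. -/
def sliceRiemann (ψ : Coord 3 → Coord 4) (μ α β ν : Fin 4) (y : Coord 3) : ℝ :=
  ∑ i, ∑ j, ∑ k, ∑ l, riemann (sliceMetric g ψ) i j k l y * sliceCoframe g ψ i μ y *
    sliceCoframe g ψ j α y * sliceCoframe g ψ k β y * sliceCoframe g ψ l ν y

/-! ### The projections of the spacetime Riemann tensor -/

/-- The Gauss projection `G_{μαβν} = R_{ρδθσ} γ^ρ_μ γ^δ_α γ^θ_β γ^σ_ν`. -/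
def gaussProj (μ α β ν : Fin 4) (x : Coord 4) : ℝ :=
  ∑ ρ, ∑ δ, ∑ θ, ∑ σ, riemann g ρ δ θ σ x *
    proj g t ρ μ x * proj g t δ α x * proj g t θ β x * proj g t σ ν x

/-- The Codazzi projection `C_{μαβ} = R_{ρδθσ} n^ρ γ^δ_β γ^θ_α γ^σ_μ`. -/
def codazziProj (μ α β : Fin 4) (x : Coord 4) : ℝ :=
  ∑ ρ, ∑ δ, ∑ θ, ∑ σ, riemann g ρ δ θ σ x *
    normal g t ρ x * proj g t δ β x * proj g t θ α x * proj g t σ μ x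

/-- The Ricci projection `R_{μν} = R_{ρδθσ} n^ρ γ^δ_ν n^θ γ^σ_μ`. -/
def ricciProj (μ ν : Fin 4) (x : Coord 4) : ℝ :=
  ∑ ρ, ∑ δ, ∑ θ, ∑ σ, riemann g ρ δ θ σ x *
    normal g t ρ x * proj g t δ ν x * normal g t θ x * proj g t σ μ x

/-! ### The 3+1 splitting of vectors -/

/-- The normal part `Φ = -n_σ v^σ` of the vector `v` at `x`. -/
def normalPart (x v : Coord 4) : ℝ := -∑ σ, normalForm g t σ x * v σ

/-- The spatial part `F^μ = γ^μ_σ v^σ` of the vector `v` at `x`. -/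
def spatialPart (x v : Coord 4) : Coord 4 := fun μ => ∑ σ, proj g t μ σ x * v σ

/-- The spatial direction `V^μ` of a vector `ℓ = S (n + V)`, with `S = -n_μ ℓ^μ`. -/
def direction (x ℓ : Coord 4) : Coord 4 := fun μ =>
  (normalPart g t x ℓ)⁻¹ * spatialPart g t x ℓ μ

/-! ### The semi-null frame and the optical tidal matrix -/

/-- The vector field `e` along the curve `c` with tangent `v` satisfies `v^α ∇_α e^μ = 0`. -/
def IsParallelAlong (c v e : ℝ → Coord 4) (I : Set ℝ) : Prop :=
  ∀ s ∈ I, ∀ μ, HasDerivAt (fun r => e r μ)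
    (-∑ α, ∑ β, christoffel g μ α β (c s) * v s α * e s β) s

/-- The vectors `φ 0 = u`, `φ 1`, `φ 2`, `φ 3 = ℓ` at `x` form a semi-null frame with
`g(u, ℓ) = Q`. -/
structure IsSemiNullFrame (x : Coord 4) (φ : Fin 4 → Coord 4) (Q : ℝ) : Prop where
  unit : scalarProd g x (φ 0) (φ 0) = -1
  null : scalarProd g x (φ 3) (φ 3) = 0
  u_dot_ℓ : scalarProd g x (φ 0) (φ 3) = Q
  u_dot : scalarProd g x (φ 0) (φ 1) = 0 ∧ scalarProd g x (φ 0) (φ 2) = 0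
  ℓ_dot : scalarProd g x (φ 3) (φ 1) = 0 ∧ scalarProd g x (φ 3) (φ 2) = 0
  orthonormal : scalarProd g x (φ 1) (φ 1) = 1 ∧ scalarProd g x (φ 2) (φ 2) = 1 ∧
    scalarProd g x (φ 1) (φ 2) = 0

/-- Along the curve `c : I → U` the vector fields `φ a` are parallel, `φ 3` is the tangent of `c`
(so that `c` is an affinely parametrized geodesic), and at the parameter value `s₀` they form a
semi-null frame. -/
structure IsTransportedSNF (U : Set (Coord 4)) (I : Set ℝ) (c : ℝ → Coord 4)
    (φ : Fin 4 → ℝ → Coord 4) (Q : ℝ) (s₀ : ℝ) : Prop where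
  mapsTo : ∀ s ∈ I, c s ∈ U
  tangent : ∀ s ∈ I, ∀ μ, HasDerivAt (fun r => c r μ) (φ 3 s μ) s
  parallel : ∀ a, IsParallelAlong g c (φ 3) (φ a) I
  initial : IsSemiNullFrame g (c s₀) (fun a => φ a s₀) Q

/-- The frame metric `h_{ab} = g(φ_a, φ_b)`. -/
def frameMetric (x : Coord 4) (φ : Fin 4 → Coord 4) : Matrix (Fin 4) (Fin 4) ℝ :=
  Matrix.of fun a b => scalarProd g x (φ a) (φ b)

/-- The matrix `h^{ab}` that raises the indices of a semi-null frame. -/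
def snfInverseMetric (Q : ℝ) : Matrix (Fin 4) (Fin 4) ℝ :=
  !![0, 0, 0, 1 / Q;
     0, 1, 0, 0;
     0, 0, 1, 0;
     1 / Q, 0, 0, 1 / Q ^ 2]

/-- The optical tidal matrix in the semi-null frame,
`R^a_{ℓℓb} = h^{ac} R_{ραβσ} φ_c^ρ ℓ^α ℓ^β φ_b^σ` with `ℓ = φ 3`. -/
def opticalTidal (x : Coord 4) (φ : Fin 4 → Coord 4) (Q : ℝ) (a b : Fin 4) : ℝ :=
  ∑ c, snfInverseMetric Q a c * riemannApply g x (φ c) (φ 3) (φ 3) (φ b)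

/-- The 3+1 bracket
`R_{βα} (Φ₁ F₂^β V^α + Φ₂ F₁^β V^α - Φ₁ Φ₂ V^β V^α - F₁^α F₂^β)`
`+ C_{σβα} (Φ₁ F₂^σ V^α V^β + Φ₂ F₁^σ V^α V^β - F₁^α F₂^σ V^β - F₂^α F₁^σ V^β)`
`+ G_{καβσ} F₁^κ V^α V^β F₂^σ`. -/
def bracket (x : Coord 4) (V : Coord 4) (Φ₁ Φ₂ : ℝ) (F₁ F₂ : Coord 4) : ℝ :=
  (∑ β, ∑ α, ricciProj g t β α x *
    (Φ₁ * F₂ β * V α + Φ₂ * F₁ β * V α - Φ₁ * Φ₂ * V β * V α - F₁ α * F₂ β))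
  + (∑ σ, ∑ β, ∑ α, codazziProj g t σ β α x *
    (Φ₁ * F₂ σ * V α * V β + Φ₂ * F₁ σ * V α * V β - F₁ α * F₂ σ * V β - F₂ α * F₁ σ * V β))
  + ∑ κ, ∑ α, ∑ β, ∑ σ, gaussProj g t κ α β σ x * F₁ κ * V α * V β * F₂ σ

end ThreePlusOne

end

/-!
The proof is pointwise linear algebra on top of three facts about the Levi-Civita connection of a
metric in coordinates, in any dimension and signature: it is metric, it has no torsion, and the
commutator of its derivatives is the curvature.

The Codazzi and Ricci relations are the two projections of the Ricci identity
`∇_σ ∇_μ n_ν - ∇_μ ∇_σ n_ν = -R^ρ_{νσμ} n_ρ` (`IsMetricOn.ricci_identity`) for the unit normal.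
Everywhere on `U` one has `∇_σ n_ρ = -K_{σρ} - n_σ a_ρ` (`nabla₁_normalForm_eq`), where the
acceleration `a` satisfies `α a_ρ = D_ρ α` (`spatialGradLapse_eq`) because `n` is proportional to
`dt`; for the same reason `K` is symmetric. Inserting this, the terms in `a` drop out of the
tangential projection, and in the other one they combine with the Lie derivative of `K`
(`lieNormalK_eq`) and the Hessian of the lapse (`spatialHessLapse_eq`).

The Gauss relation is about a map `ψ : ℝ³ → ℝ⁴` rather than a region of spacetime, so covariant
derivatives are taken along maps (`covAlong`). For every smooth `ψ : ℝᵐ → ℝᵈ` the curvature on the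
tangent vectors `∂_i ψ` is a combination of first derivatives of the lowered Christoffel symbols of
the pulled back metric and of the products `g(∇_j ∂_l ψ, ∇_i ∂_k ψ)` (`riemannApply_tangentField`).
This is used for the slice and, with `ψ` the identity, for the induced metric. The Christoffel
symbols agree by Koszul's formula; the products differ by the normal components of `∇_i ∂_j ψ`,
which are `K_{ij}` (`IsSliceParam.normalForm_covAlong`). Splitting off these components requires the
induced metric to be nondegenerate, which holds because the orthogonal complement of a timelike
vector is positive definite (`IsLorentzMetricOn.scalarProd_self_pos`). The identity map also gives
the antisymmetry of the Riemann tensor in its first pair of indices.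

Along the ray the scalar products of the parallel frame are constant, so that it is a semi-null
frame at every point. Its null vector is not tangent to a slice, since tangent vectors are
spacelike, and this is `S ≠ 0`. The 3+1 form of the tidal matrix is then the multilinear expansion
of `R(φ_a, ℓ, ℓ, φ_b)` simplified by the symmetries of the Riemann tensor
(`riemannApply_eq_bracket`), and the vanishing components are `R(ℓ, ℓ, ·, ·)` and `R(·, ·, ℓ, ℓ)`.
-/

noncomputable section

namespace ThreePlusOne

/-! ### Reordering of iterated sums -/

theorem sum_pull_third {ι₁ ι₂ ι₃ : Type*} [Fintype ι₁] [Fintype ι₂] [Fintype ι₃]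
    (f : ι₁ → ι₂ → ι₃ → ℝ) : ∑ a, ∑ b, ∑ c, f a b c = ∑ c, ∑ a, ∑ b, f a b c := by
  rw [Finset.sum_comm]
  simp_rw [Finset.sum_comm (s := (Finset.univ : Finset ι₁)) (t := (Finset.univ : Finset ι₃))]
  rw [Finset.sum_comm]
  exact Finset.sum_congr rfl fun _ _ => Finset.sum_comm

theorem sum_pull_fourth {ι₁ ι₂ ι₃ ι₄ : Type*} [Fintype ι₁] [Fintype ι₂] [Fintype ι₃] [Fintype ι₄]
    (f : ι₁ → ι₂ → ι₃ → ι₄ → ℝ) :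
    ∑ a, ∑ b, ∑ c, ∑ e, f a b c e = ∑ e, ∑ a, ∑ b, ∑ c, f a b c e := by
  calc _ = ∑ a, ∑ e, ∑ b, ∑ c, f a b c e := Finset.sum_congr rfl fun _ _ => sum_pull_third _
    _ = _ := Finset.sum_comm

theorem sum_pull_fifth {ι₁ ι₂ ι₃ ι₄ ι₅ : Type*} [Fintype ι₁] [Fintype ι₂] [Fintype ι₃] [Fintype ι₄]
    [Fintype ι₅] (f : ι₁ → ι₂ → ι₃ → ι₄ → ι₅ → ℝ) :
    ∑ a, ∑ b, ∑ c, ∑ e, ∑ i, f a b c e i = ∑ i, ∑ a, ∑ b, ∑ c, ∑ e, f a b c e i :=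
  (Finset.sum_congr rfl fun _ _ => sum_pull_fourth _).trans Finset.sum_comm

/-! ### Calculus of partial derivatives -/

section Calculus

variable {d : ℕ} {x : Coord d} {O : Set (Coord d)} {f h : Coord d → ℝ}

theorem differentiableAt_of_smoothOn (hO : IsOpen O) (hf : ContDiffOn ℝ ∞ f O) (hx : x ∈ O) :
    DifferentiableAt ℝ f x :=
  (hf.contDiffAt (hO.mem_nhds hx)).differentiableAt (by simp)

theorem pd_congr_of_eqOn (hO : IsOpen O) (hx : x ∈ O) (hfh : ∀ y ∈ O, f y = h y) (μ : Fin d) :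
    pd μ f x = pd μ h x := by
  have : f =ᶠ[nhds x] h := Filter.eventuallyEq_of_mem (hO.mem_nhds hx) hfh
  rw [pd, pd, this.fderiv_eq]

theorem pd_add (hf : DifferentiableAt ℝ f x) (hh : DifferentiableAt ℝ h x) (μ : Fin d) :
    pd μ (fun y => f y + h y) x = pd μ f x + pd μ h x := by
  simp [pd, fderiv_fun_add hf hh]

theorem pd_sub (hf : DifferentiableAt ℝ f x) (hh : DifferentiableAt ℝ h x) (μ : Fin d) :
    pd μ (fun y => f y - h y) x = pd μ f x - pd μ h x := by
  simp [pd, fderiv_fun_sub hf hh]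

theorem pd_neg (μ : Fin d) : pd μ (fun y => -f y) x = -pd μ f x := by
  simp [pd, fderiv_fun_neg]

theorem pd_const (c : ℝ) (μ : Fin d) : pd μ (fun _ => c) x = 0 := by
  simp [pd]

theorem pd_mul (hf : DifferentiableAt ℝ f x) (hh : DifferentiableAt ℝ h x) (μ : Fin d) :
    pd μ (fun y => f y * h y) x = pd μ f x * h x + f x * pd μ h x := by
  simp [pd, fderiv_fun_mul hf hh]
  ring

theorem pd_sum {ι : Type*} {s : Finset ι} {F : ι → Coord d → ℝ}
    (hF : ∀ i ∈ s, DifferentiableAt ℝ (F i) x) (μ : Fin d) :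
    pd μ (fun y => ∑ i ∈ s, F i y) x = ∑ i ∈ s, pd μ (F i) x := by
  simp [pd, fderiv_fun_sum hF]

theorem fderiv_apply_eq_sum_pd (v : Coord d) : fderiv ℝ f x v = ∑ μ, v μ * pd μ f x := by
  conv_lhs => rw [pi_eq_sum_univ' v]
  simp [pd]

/-- The chain rule for a function on `ℝᵈ` along a map `ψ : ℝᵐ → ℝᵈ`. -/
theorem pd_comp {m : ℕ} {ψ : Coord m → Coord d} {y : Coord m} (hf : DifferentiableAt ℝ f (ψ y))
    (hψ : ∀ μ, DifferentiableAt ℝ (fun z => ψ z μ) y) (i : Fin m) :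
    pd i (fun z => f (ψ z)) y = ∑ μ, pd i (fun z => ψ z μ) y * pd μ f (ψ y) := by
  have hψ' : DifferentiableAt ℝ ψ y := differentiableAt_pi.2 hψ
  have h1 : fderiv ℝ (fun z => f (ψ z)) y = (fderiv ℝ f (ψ y)).comp (fderiv ℝ ψ y) :=
    fderiv_comp y hf hψ'
  rw [pd, h1, ContinuousLinearMap.comp_apply, fderiv_apply_eq_sum_pd]
  refine Finset.sum_congr rfl fun μ _ => ?_
  rw [pd, fderiv_pi hψ]
  rfl

theorem pd_coord (μ ν : Fin d) : pd μ (fun y => y ν) x = if μ = ν then 1 else 0 := by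
  have : (fun y : Coord d => y ν) = (ContinuousLinearMap.proj (R := ℝ) (φ := fun _ => ℝ) ν) := rfl
  rw [pd, this, ContinuousLinearMap.fderiv]
  simp [Pi.single_apply, eq_comm]

theorem smoothOn_pd (hO : IsOpen O) (hf : ContDiffOn ℝ ∞ f O) (μ : Fin d) :
    ContDiffOn ℝ ∞ (pd μ f) O :=
  (hf.fderiv_of_isOpen hO (by simp)).clm_apply contDiffOn_const

/-- Partial derivatives of smooth functions commute. -/
theorem pd_comm (hO : IsOpen O) (hf : ContDiffOn ℝ ∞ f O) (hx : x ∈ O) (μ ν : Fin d) :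
    pd μ (pd ν f) x = pd ν (pd μ f) x := by
  have hfx := hf.contDiffAt (hO.mem_nhds hx)
  have hd : DifferentiableAt ℝ (fderiv ℝ f) x :=
    ((hf.fderiv_of_isOpen (m := ∞) hO (by simp)).contDiffAt (hO.mem_nhds hx)).differentiableAt
      (by simp)
  have key : ∀ a b : Fin d, pd a (pd b f) x
      = fderiv ℝ (fderiv ℝ f) x (Pi.single a 1) (Pi.single b 1) := by
    intro a b
    have : pd b f = fun y => fderiv ℝ f y (Pi.single b 1) := rfl
    rw [this, pd, fderiv_clm_apply hd (differentiableAt_const _)]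
    simp
  rw [key, key]
  exact (hfx.isSymmSndFDerivAt (by
    simpa using (WithTop.coe_le_coe.2 le_top : ((2 : ℕ∞) : WithTop ℕ∞) ≤ ∞))).eq _ _

theorem smoothOn_det {ι : Type*} [Fintype ι] [DecidableEq ι] {M : Coord d → Matrix ι ι ℝ}
    (hM : ∀ i j, ContDiffOn ℝ ∞ (fun y => M y i j) O) : ContDiffOn ℝ ∞ (fun y => (M y).det) O := by
  simp only [Matrix.det_apply]
  refine ContDiffOn.sum fun σ _ => ?_
  refine ContDiffOn.const_smul _ ?_
  exact contDiffOn_prod fun i _ => hM _ _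

theorem smoothOn_matrix_inv {ι : Type*} [Fintype ι] [DecidableEq ι] {M : Coord d → Matrix ι ι ℝ}
    (hM : ∀ i j, ContDiffOn ℝ ∞ (fun y => M y i j) O) (hdet : ∀ y ∈ O, (M y).det ≠ 0) (i j : ι) :
    ContDiffOn ℝ ∞ (fun y => (M y)⁻¹ i j) O := by
  simp only [Matrix.inv_def, Ring.inverse_eq_inv', Matrix.smul_apply, smul_eq_mul,
    Matrix.adjugate_apply]
  refine ((smoothOn_det hM).inv hdet).mul (smoothOn_det fun a b => ?_)
  by_cases h : a = j
  · subst h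
    simpa using contDiffOn_const
  · simpa [Matrix.updateRow_apply, h] using hM a b

end Calculus

/-! ### Metrics and their Christoffel symbols -/

/-- A smooth nondegenerate symmetric metric, of any signature, on an open set of `ℝᵈ`. -/
structure IsMetricOn {d : ℕ} (g : MetricField d) (O : Set (Coord d)) : Prop where
  isOpen : IsOpen O
  smooth : ∀ μ ν, ContDiffOn ℝ ∞ (fun x => g x μ ν) O
  symm : ∀ x ∈ O, ∀ μ ν, g x μ ν = g x ν μ
  det_ne_zero : ∀ x ∈ O, (g x).det ≠ 0

section Metric

variable {d : ℕ} {g : MetricField d} {O : Set (Coord d)} {x : Coord d}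

namespace IsMetricOn

theorem smooth_inv (hg : IsMetricOn g O) (μ ν : Fin d) :
    ContDiffOn ℝ ∞ (fun x => (g x)⁻¹ μ ν) O :=
  smoothOn_matrix_inv hg.smooth hg.det_ne_zero μ ν

theorem differentiableAt (hg : IsMetricOn g O) (hx : x ∈ O) (μ ν : Fin d) :
    DifferentiableAt ℝ (fun x => g x μ ν) x :=
  differentiableAt_of_smoothOn hg.isOpen (hg.smooth μ ν) hx

theorem sum_mul_inv (hg : IsMetricOn g O) (hx : x ∈ O) (μ ν : Fin d) :
    ∑ κ, g x μ κ * (g x)⁻¹ κ ν = if μ = ν then 1 else 0 := by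
  have := Matrix.mul_nonsing_inv (g x) (isUnit_iff_ne_zero.2 (hg.det_ne_zero x hx))
  simpa [Matrix.mul_apply, Matrix.one_apply] using congrFun (congrFun this μ) ν

theorem sum_inv_mul (hg : IsMetricOn g O) (hx : x ∈ O) (μ ν : Fin d) :
    ∑ κ, (g x)⁻¹ μ κ * g x κ ν = if μ = ν then 1 else 0 := by
  have := Matrix.nonsing_inv_mul (g x) (isUnit_iff_ne_zero.2 (hg.det_ne_zero x hx))
  simpa [Matrix.mul_apply, Matrix.one_apply] using congrFun (congrFun this μ) ν

theorem inv_symm (hg : IsMetricOn g O) (hx : x ∈ O) (μ ν : Fin d) :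
    (g x)⁻¹ μ ν = (g x)⁻¹ ν μ := by
  have h : (g x).transpose = g x := by ext a b; exact hg.symm x hx b a
  have h2 : ((g x)⁻¹).transpose = (g x)⁻¹ := by rw [Matrix.transpose_nonsing_inv, h]
  exact congrFun (congrFun h2 ν) μ

theorem pd_symm (hg : IsMetricOn g O) (hx : x ∈ O) (κ μ ν : Fin d) :
    pd κ (fun y => g y μ ν) x = pd κ (fun y => g y ν μ) x :=
  pd_congr_of_eqOn hg.isOpen hx (fun y hy => hg.symm y hy μ ν) κ

theorem lower_raise (hg : IsMetricOn g O) (hx : x ∈ O) (w : Fin d → ℝ) (μ : Fin d) :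
    ∑ κ, g x μ κ * ∑ ρ, (g x)⁻¹ κ ρ * w ρ = w μ := by
  simp only [Finset.mul_sum, ← mul_assoc]
  rw [Finset.sum_comm]
  simp [← Finset.sum_mul, hg.sum_mul_inv hx]

theorem raise_lower (hg : IsMetricOn g O) (hx : x ∈ O) (w : Fin d → ℝ) (μ : Fin d) :
    ∑ κ, (g x)⁻¹ μ κ * ∑ ρ, g x κ ρ * w ρ = w μ := by
  simp only [Finset.mul_sum, ← mul_assoc]
  rw [Finset.sum_comm]
  simp [← Finset.sum_mul, hg.sum_inv_mul hx]

theorem smooth_christoffel (hg : IsMetricOn g O) (μ α β : Fin d) :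
    ContDiffOn ℝ ∞ (christoffel g μ α β) O := by
  unfold christoffel
  refine contDiffOn_const.mul (ContDiffOn.sum fun ρ _ => (hg.smooth_inv μ ρ).mul ?_)
  exact ((smoothOn_pd hg.isOpen (hg.smooth _ _) _).add
    (smoothOn_pd hg.isOpen (hg.smooth _ _) _)).sub (smoothOn_pd hg.isOpen (hg.smooth _ _) _)

theorem christoffel_symm (hg : IsMetricOn g O) (hx : x ∈ O) (μ α β : Fin d) :
    christoffel g μ α β x = christoffel g μ β α x := by
  unfold christoffel
  congr 1
  refine Finset.sum_congr rfl fun ρ _ => ?_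
  rw [hg.pd_symm hx α ρ β, hg.pd_symm hx β α ρ, hg.pd_symm hx ρ α β]
  ring

/-- The Christoffel symbols with the first index lowered. -/
theorem lower_christoffel (hg : IsMetricOn g O) (hx : x ∈ O) (κ α β : Fin d) :
    ∑ μ, g x κ μ * christoffel g μ α β x =
      1 / 2 * (pd α (fun y => g y κ β) x + pd β (fun y => g y α κ) x
        - pd κ (fun y => g y α β) x) := by
  unfold christoffel
  have := hg.lower_raise hx (fun ρ => pd α (fun y => g y ρ β) x + pd β (fun y => g y α ρ) x
        - pd ρ (fun y => g y α β) x) κ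
  rw [← this, Finset.mul_sum]
  exact Finset.sum_congr rfl fun _ _ => by ring

/-- The Levi-Civita connection is metric: `∂_κ g_{μν} = Γ_{νκμ} + Γ_{μκν}`. -/
theorem pd_metric (hg : IsMetricOn g O) (hx : x ∈ O) (κ μ ν : Fin d) :
    pd κ (fun y => g y μ ν) x =
      ∑ ρ, g x ν ρ * christoffel g ρ κ μ x + ∑ ρ, g x μ ρ * christoffel g ρ κ ν x := by
  rw [hg.lower_christoffel hx, hg.lower_christoffel hx, hg.pd_symm hx κ ν μ,
    hg.pd_symm hx μ κ ν, hg.pd_symm hx ν κ μ]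
  ring

end IsMetricOn

end Metric

/-! ### Algebra of the scalar product -/

section ScalarProd

variable {d : ℕ} (g : MetricField d) (x : Coord d)

theorem scalarProd_add_left (u v w : Coord d) :
    scalarProd g x (fun μ => u μ + v μ) w = scalarProd g x u w + scalarProd g x v w := by
  simp only [scalarProd, mul_add, add_mul, Finset.sum_add_distrib]

theorem scalarProd_sub_left (u v w : Coord d) :
    scalarProd g x (fun μ => u μ - v μ) w = scalarProd g x u w - scalarProd g x v w := by
  simp only [scalarProd, mul_sub, sub_mul, Finset.sum_sub_distrib]

theorem scalarProd_add_right (u v w : Coord d) :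
    scalarProd g x u (fun μ => v μ + w μ) = scalarProd g x u v + scalarProd g x u w := by
  simp only [scalarProd, mul_add, Finset.sum_add_distrib]

theorem scalarProd_smul_left (a : ℝ) (v w : Coord d) :
    scalarProd g x (fun μ => a * v μ) w = a * scalarProd g x v w := by
  simp only [scalarProd, Finset.mul_sum]
  exact Finset.sum_congr rfl fun _ _ => Finset.sum_congr rfl fun _ _ => by ring

theorem scalarProd_sum_left {ι : Type*} (s : Finset ι) (v : ι → Coord d) (w : Coord d) :
    scalarProd g x (fun μ => ∑ i ∈ s, v i μ) w = ∑ i ∈ s, scalarProd g x (v i) w := by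
  simp only [scalarProd, Finset.mul_sum, Finset.sum_mul]
  rw [Finset.sum_comm (s := s)]
  exact Finset.sum_congr rfl fun _ _ => Finset.sum_comm

variable {g x} {O : Set (Coord d)}

theorem IsMetricOn.scalarProd_comm (hg : IsMetricOn g O) (hx : x ∈ O) (v w : Coord d) :
    scalarProd g x v w = scalarProd g x w v := by
  unfold scalarProd
  rw [Finset.sum_comm]
  refine Finset.sum_congr rfl fun _ _ => Finset.sum_congr rfl fun _ _ => ?_
  rw [hg.symm x hx]
  ring

/-- The Leibniz rule behind metric compatibility: the derivative of `g` in the direction `w` is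
accounted for by the Christoffel terms of the two arguments. -/
theorem IsMetricOn.sum_pd_metric (hg : IsMetricOn g O) (hx : x ∈ O) (w a b : Coord d) :
    ∑ μ, ∑ ν, (∑ κ, w κ * pd κ (fun y => g y μ ν) x) * a μ * b ν =
      scalarProd g x (fun μ => ∑ α, ∑ β, christoffel g μ α β x * w α * a β) b +
        scalarProd g x a (fun μ => ∑ α, ∑ β, christoffel g μ α β x * w α * b β) := by
  simp only [hg.pd_metric hx, scalarProd, mul_add, add_mul, Finset.sum_add_distrib,
    Finset.mul_sum, Finset.sum_mul]
  congr 1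
  · rw [sum_pull_fourth]
    refine Finset.sum_congr rfl fun ρ _ => ?_
    rw [← sum_pull_third]
    refine Finset.sum_congr rfl fun ν _ => Finset.sum_congr rfl fun κ _ =>
      Finset.sum_congr rfl fun μ _ => ?_
    rw [hg.symm x hx ν ρ]
    ring
  · refine Finset.sum_congr rfl fun μ _ => ?_
    rw [sum_pull_third]
    refine Finset.sum_congr rfl fun ρ _ => ?_
    rw [Finset.sum_comm]
    refine Finset.sum_congr rfl fun κ _ => Finset.sum_congr rfl fun ν _ => ?_
    ring

end ScalarProd

/-! ### Covariant differentiation along a map -/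

/-- The covariant derivative `(∇_i Z)^μ = ∂_i Z^μ + Γ^μ_{αβ} ∂_i ψ^α Z^β` of a vector field `Z`
along a map `ψ : ℝᵐ → ℝᵈ`, that is, of a field `Z(y)` of vectors at the points `ψ(y)`. -/
def covAlong {m d : ℕ} (g : MetricField d) (ψ : Coord m → Coord d) (Z : Fin d → Coord m → ℝ)
    (i : Fin m) (μ : Fin d) (y : Coord m) : ℝ :=
  pd i (Z μ) y + ∑ α, ∑ β, christoffel g μ α β (ψ y) * pd i (fun z => ψ z α) y * Z β y

/-- The coordinate vector field `∂_l ψ^μ` along `ψ`. -/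
def tangentField {m d : ℕ} (ψ : Coord m → Coord d) (l : Fin m) (μ : Fin d) (y : Coord m) : ℝ :=
  pd l (fun z => ψ z μ) y

/-- A smooth map from an open set `W` of `ℝᵐ` into `O`. -/
structure IsSmoothMapInto {m d : ℕ} (ψ : Coord m → Coord d) (W : Set (Coord m))
    (O : Set (Coord d)) : Prop where
  isOpen : IsOpen W
  smooth : ∀ μ, ContDiffOn ℝ ∞ (fun y => ψ y μ) W
  mapsTo : ∀ y ∈ W, ψ y ∈ O

section CovAlong

variable {m d : ℕ} {g : MetricField d} {O : Set (Coord d)} {ψ : Coord m → Coord d}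
  {W : Set (Coord m)} {y : Coord m} {Z Y : Fin d → Coord m → ℝ}

theorem IsSmoothMapInto.comp (hψ : IsSmoothMapInto ψ W O) {f : Coord d → ℝ}
    (hf : ContDiffOn ℝ ∞ f O) : ContDiffOn ℝ ∞ (fun y => f (ψ y)) W :=
  hf.comp (contDiffOn_pi.2 hψ.smooth) hψ.mapsTo

theorem IsSmoothMapInto.smooth_tangentField (hψ : IsSmoothMapInto ψ W O) (l : Fin m) (μ : Fin d) :
    ContDiffOn ℝ ∞ (tangentField ψ l μ) W :=
  smoothOn_pd hψ.isOpen (hψ.smooth μ) l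

theorem IsSmoothMapInto.pd_comp (hψ : IsSmoothMapInto ψ W O) (hO : IsOpen O) {f : Coord d → ℝ}
    (hf : ContDiffOn ℝ ∞ f O) (hy : y ∈ W) (i : Fin m) :
    pd i (fun z => f (ψ z)) y = ∑ μ, tangentField ψ i μ y * pd μ f (ψ y) :=
  ThreePlusOne.pd_comp (differentiableAt_of_smoothOn hO hf (hψ.mapsTo y hy))
    (fun μ => differentiableAt_of_smoothOn hψ.isOpen (hψ.smooth μ) hy) i

theorem smooth_covAlong (hg : IsMetricOn g O) (hψ : IsSmoothMapInto ψ W O)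
    (hZ : ∀ μ, ContDiffOn ℝ ∞ (Z μ) W) (i : Fin m) (μ : Fin d) :
    ContDiffOn ℝ ∞ (covAlong g ψ Z i μ) W := by
  unfold covAlong
  refine (smoothOn_pd hψ.isOpen (hZ μ) i).add
    (ContDiffOn.sum fun α _ => ContDiffOn.sum fun β _ => ?_)
  exact ((hψ.comp (hg.smooth_christoffel μ α β)).mul (hψ.smooth_tangentField i α)).mul (hZ β)

theorem smooth_scalarProd_along (hg : IsMetricOn g O) (hψ : IsSmoothMapInto ψ W O)
    (hZ : ∀ μ, ContDiffOn ℝ ∞ (Z μ) W) (hY : ∀ μ, ContDiffOn ℝ ∞ (Y μ) W) :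
    ContDiffOn ℝ ∞ (fun z => scalarProd g (ψ z) (fun μ => Z μ z) (fun μ => Y μ z)) W := by
  unfold scalarProd
  exact ContDiffOn.sum fun α _ => ContDiffOn.sum fun β _ =>
    ((hψ.comp (hg.smooth α β)).mul (hZ α)).mul (hY β)

/-- Metric compatibility of the connection along `ψ`. -/
theorem pd_scalarProd_along (hg : IsMetricOn g O) (hψ : IsSmoothMapInto ψ W O) (hy : y ∈ W)
    (hZ : ∀ μ, ContDiffOn ℝ ∞ (Z μ) W) (hY : ∀ μ, ContDiffOn ℝ ∞ (Y μ) W) (i : Fin m) :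
    pd i (fun z => scalarProd g (ψ z) (fun μ => Z μ z) (fun μ => Y μ z)) y =
      scalarProd g (ψ y) (fun μ => covAlong g ψ Z i μ y) (fun μ => Y μ y) +
        scalarProd g (ψ y) (fun μ => Z μ y) (fun μ => covAlong g ψ Y i μ y) := by
  have dZ := fun μ => differentiableAt_of_smoothOn hψ.isOpen (hZ μ) hy
  have dY := fun μ => differentiableAt_of_smoothOn hψ.isOpen (hY μ) hy
  have dg := fun μ ν => differentiableAt_of_smoothOn hψ.isOpen (hψ.comp (hg.smooth μ ν)) hy
  have e : pd i (fun z => scalarProd g (ψ z) (fun μ => Z μ z) (fun μ => Y μ z)) y =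
      (∑ μ, ∑ ν, (∑ κ, tangentField ψ i κ y * pd κ (fun x => g x μ ν) (ψ y)) * Z μ y * Y ν y) +
      scalarProd g (ψ y) (fun μ => pd i (Z μ) y) (fun μ => Y μ y) +
      scalarProd g (ψ y) (fun μ => Z μ y) (fun μ => pd i (Y μ) y) := by
    have dp : ∀ μ ν, DifferentiableAt ℝ (fun z => g (ψ z) μ ν * Z μ z * Y ν z) y :=
      fun μ ν => ((dg μ ν).mul (dZ μ)).mul (dY ν)
    unfold scalarProd
    rw [pd_sum (fun μ _ => DifferentiableAt.fun_sum fun ν _ => dp μ ν), ← Finset.sum_add_distrib,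
      ← Finset.sum_add_distrib]
    refine Finset.sum_congr rfl fun μ _ => ?_
    rw [pd_sum (fun ν _ => dp μ ν), ← Finset.sum_add_distrib, ← Finset.sum_add_distrib]
    refine Finset.sum_congr rfl fun ν _ => ?_
    rw [pd_mul (f := fun z => g (ψ z) μ ν * Z μ z) ((dg μ ν).mul (dZ μ)) (dY ν),
      pd_mul (dg μ ν) (dZ μ),
      hψ.pd_comp hg.isOpen (hg.smooth μ ν) hy]
    ring
  rw [e, hg.sum_pd_metric (hψ.mapsTo y hy)]
  unfold covAlong
  rw [scalarProd_add_left, scalarProd_add_right]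
  simp only [tangentField]
  ring

/-- The connection along `ψ` has no torsion. -/
theorem covAlong_tangentField_comm (hg : IsMetricOn g O) (hψ : IsSmoothMapInto ψ W O)
    (hy : y ∈ W) (i j : Fin m) (μ : Fin d) :
    covAlong g ψ (tangentField ψ j) i μ y = covAlong g ψ (tangentField ψ i) j μ y := by
  unfold covAlong
  congr 1
  · exact pd_comm hψ.isOpen (hψ.smooth μ) hy i j
  · rw [Finset.sum_comm]
    refine Finset.sum_congr rfl fun α _ => Finset.sum_congr rfl fun β _ => ?_
    rw [hg.christoffel_symm (hψ.mapsTo y hy)]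
    simp only [tangentField]
    ring

theorem covAlong_covAlong (hg : IsMetricOn g O) (hψ : IsSmoothMapInto ψ W O) (hy : y ∈ W)
    (hZ : ∀ μ, ContDiffOn ℝ ∞ (Z μ) W) (i j : Fin m) (μ : Fin d) :
    covAlong g ψ (covAlong g ψ Z j) i μ y =
      pd i (pd j (Z μ)) y
      + ∑ α, ∑ β, christoffel g μ α β (ψ y) * pd i (tangentField ψ j α) y * Z β y
      + ∑ α, ∑ β, christoffel g μ α β (ψ y) * tangentField ψ j α y * pd i (Z β) y
      + ∑ α, ∑ β, christoffel g μ α β (ψ y) * tangentField ψ i α y * pd j (Z β) y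
      + ∑ α, ∑ β, ∑ σ, (pd α (christoffel g μ β σ) (ψ y)
          + ∑ κ, christoffel g μ α κ (ψ y) * christoffel g κ β σ (ψ y))
          * Z σ y * tangentField ψ i α y * tangentField ψ j β y := by
  have dZ := fun μ => differentiableAt_of_smoothOn hψ.isOpen (hZ μ) hy
  have dZ' := fun μ => differentiableAt_of_smoothOn hψ.isOpen (smoothOn_pd hψ.isOpen (hZ μ) j) hy
  have dC := fun μ α β =>
    differentiableAt_of_smoothOn hψ.isOpen (hψ.comp (hg.smooth_christoffel μ α β)) hy
  have dt := fun l μ => differentiableAt_of_smoothOn hψ.isOpen (hψ.smooth_tangentField l μ) hy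
  have e : pd i (covAlong g ψ Z j μ) y = pd i (pd j (Z μ)) y
      + ∑ α, ∑ β, ((∑ κ, tangentField ψ i κ y * pd κ (christoffel g μ α β) (ψ y))
            * tangentField ψ j α y * Z β y
        + christoffel g μ α β (ψ y) * pd i (tangentField ψ j α) y * Z β y
        + christoffel g μ α β (ψ y) * tangentField ψ j α y * pd i (Z β) y) := by
    have : covAlong g ψ Z j μ = fun y => pd j (Z μ) y
      + ∑ α, ∑ β, christoffel g μ α β (ψ y) * tangentField ψ j α y * Z β y := rfl
    rw [this, pd_add (by fun_prop) (by fun_prop), pd_sum (fun μ _ => by fun_prop)]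
    congr 1
    refine Finset.sum_congr rfl fun α _ => ?_
    rw [pd_sum (fun ν _ => by fun_prop)]
    refine Finset.sum_congr rfl fun β _ => ?_
    rw [pd_mul (by fun_prop) (by fun_prop), pd_mul (by fun_prop) (by fun_prop),
      hψ.pd_comp hg.isOpen (hg.smooth_christoffel μ α β) hy]
    ring
  have e1 : ∑ α, ∑ β, (∑ κ, tangentField ψ i κ y * pd κ (christoffel g μ α β) (ψ y))
            * tangentField ψ j α y * Z β y =
      ∑ α, ∑ β, ∑ σ, pd α (christoffel g μ β σ) (ψ y)
          * Z σ y * tangentField ψ i α y * tangentField ψ j β y := by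
    simp only [Finset.sum_mul]
    rw [sum_pull_third]
    exact Finset.sum_congr rfl fun _ _ => Finset.sum_congr rfl fun _ _ =>
      Finset.sum_congr rfl fun _ _ => by ring
  have e2 : ∑ α, ∑ κ, christoffel g μ α κ (ψ y) * tangentField ψ i α y *
        (∑ β, ∑ σ, christoffel g κ β σ (ψ y) * tangentField ψ j β y * Z σ y) =
      ∑ α, ∑ β, ∑ σ, (∑ κ, christoffel g μ α κ (ψ y) * christoffel g κ β σ (ψ y))
          * Z σ y * tangentField ψ i α y * tangentField ψ j β y := by
    simp only [Finset.mul_sum, Finset.sum_mul]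
    refine Finset.sum_congr rfl fun α _ => ?_
    rw [← sum_pull_third]
    exact Finset.sum_congr rfl fun _ _ => Finset.sum_congr rfl fun _ _ =>
      Finset.sum_congr rfl fun _ _ => by ring
  have e3 : covAlong g ψ (covAlong g ψ Z j) i μ y = pd i (covAlong g ψ Z j μ) y +
      (∑ α, ∑ β, christoffel g μ α β (ψ y) * tangentField ψ i α y * pd j (Z β) y
      + ∑ α, ∑ κ, christoffel g μ α κ (ψ y) * tangentField ψ i α y *
        (∑ β, ∑ σ, christoffel g κ β σ (ψ y) * tangentField ψ j β y * Z σ y)) := by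
    rw [covAlong]
    simp only [covAlong, tangentField, mul_add, Finset.sum_add_distrib]
  rw [e3, e, e2]
  simp only [Finset.sum_add_distrib, add_mul]
  rw [e1]
  ring

/-- The commutator of covariant derivatives along `ψ` is the curvature. -/
theorem covAlong_commutator (hg : IsMetricOn g O) (hψ : IsSmoothMapInto ψ W O) (hy : y ∈ W)
    (hZ : ∀ μ, ContDiffOn ℝ ∞ (Z μ) W) (i j : Fin m) (μ : Fin d) :
    covAlong g ψ (covAlong g ψ Z j) i μ y - covAlong g ψ (covAlong g ψ Z i) j μ y =
      ∑ σ, ∑ α, ∑ β, riemannUp g μ σ α β (ψ y) * Z σ y * tangentField ψ i α y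
        * tangentField ψ j β y := by
  rw [covAlong_covAlong hg hψ hy hZ, covAlong_covAlong hg hψ hy hZ, pd_comm hψ.isOpen (hZ μ) hy i j]
  have h : ∀ α, pd i (tangentField ψ j α) y = pd j (tangentField ψ i α) y :=
    fun α => pd_comm hψ.isOpen (hψ.smooth α) hy i j
  have hswap : ∑ α, ∑ β, ∑ σ, (pd α (christoffel g μ β σ) (ψ y)
          + ∑ κ, christoffel g μ α κ (ψ y) * christoffel g κ β σ (ψ y))
          * Z σ y * tangentField ψ j α y * tangentField ψ i β y =
      ∑ α, ∑ β, ∑ σ, (pd β (christoffel g μ α σ) (ψ y)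
          + ∑ κ, christoffel g μ β κ (ψ y) * christoffel g κ α σ (ψ y))
          * Z σ y * tangentField ψ i α y * tangentField ψ j β y := by
    rw [Finset.sum_comm]
    exact Finset.sum_congr rfl fun _ _ => Finset.sum_congr rfl fun _ _ =>
      Finset.sum_congr rfl fun _ _ => by ring
  have hR : ∑ σ, ∑ α, ∑ β, riemannUp g μ σ α β (ψ y) * Z σ y * tangentField ψ i α y
        * tangentField ψ j β y =
      ∑ α, ∑ β, ∑ σ, (pd α (christoffel g μ β σ) (ψ y)
          + ∑ κ, christoffel g μ α κ (ψ y) * christoffel g κ β σ (ψ y))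
          * Z σ y * tangentField ψ i α y * tangentField ψ j β y
      - ∑ α, ∑ β, ∑ σ, (pd β (christoffel g μ α σ) (ψ y)
          + ∑ κ, christoffel g μ β κ (ψ y) * christoffel g κ α σ (ψ y))
          * Z σ y * tangentField ψ i α y * tangentField ψ j β y := by
    rw [← sum_pull_third]
    simp only [← Finset.sum_sub_distrib]
    refine Finset.sum_congr rfl fun α _ => Finset.sum_congr rfl fun β _ =>
      Finset.sum_congr rfl fun σ _ => ?_
    rw [riemannUp, Finset.sum_sub_distrib]
    ring
  rw [hR, hswap]
  simp only [h]
  ring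

theorem riemannApply_eq_scalarProd (x a b c e : Coord d) :
    riemannApply g x a b c e =
      scalarProd g x a (fun μ => ∑ σ, ∑ α, ∑ β, riemannUp g μ σ α β x * b σ * c α * e β) := by
  unfold riemannApply scalarProd riemann
  refine Finset.sum_congr rfl fun ρ _ => ?_
  simp only [Finset.mul_sum, Finset.sum_mul]
  rw [sum_pull_fourth]
  exact Finset.sum_congr rfl fun _ _ => Finset.sum_congr rfl fun _ _ =>
    Finset.sum_congr rfl fun _ _ => Finset.sum_congr rfl fun _ _ => by ring

/-- The Christoffel symbols `g(∇_j ∂_l ψ, ∂_k ψ)` of the pulled back metric, first index lowered. -/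
def lowerChristoffel (g : MetricField d) (ψ : Coord m → Coord d) (k j l : Fin m)
    (y : Coord m) : ℝ :=
  scalarProd g (ψ y) (fun μ => covAlong g ψ (tangentField ψ l) j μ y)
    (fun μ => tangentField ψ k μ y)

/-- Koszul's formula for the pulled back metric. -/
theorem lowerChristoffel_eq (hg : IsMetricOn g O) (hψ : IsSmoothMapInto ψ W O) (hy : y ∈ W)
    (G : MetricField m)
    (hG : ∀ a b, ∀ z ∈ W, G z a b =
      scalarProd g (ψ z) (fun μ => tangentField ψ a μ z) (fun μ => tangentField ψ b μ z))
    (k j l : Fin m) :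
    lowerChristoffel g ψ k j l y =
      1 / 2 * (pd j (fun z => G z k l) y + pd l (fun z => G z j k) y
        - pd k (fun z => G z j l) y) := by
  have key : ∀ i a b, pd i (fun z => G z a b) y =
      lowerChristoffel g ψ b i a y + lowerChristoffel g ψ a i b y := by
    intro i a b
    rw [pd_congr_of_eqOn hψ.isOpen hy (hG a b), pd_scalarProd_along hg hψ hy
      (hψ.smooth_tangentField a) (hψ.smooth_tangentField b)]
    rw [hg.scalarProd_comm (hψ.mapsTo y hy) (fun μ => tangentField ψ a μ y)]
    rfl
  have sy : ∀ k i a, lowerChristoffel g ψ k i a y = lowerChristoffel g ψ k a i y := by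
    intro k i a
    unfold lowerChristoffel
    simp only [covAlong_tangentField_comm hg hψ hy i a]
  rw [key, key, key, sy k l j, sy l k j, sy j l k]
  ring

/-- The curvature of the ambient metric on the tangent vectors of `ψ`, in terms of first
derivatives of the lowered Christoffel symbols of the pulled back metric and of the scalar
products of the second covariant derivatives of `ψ`. -/
theorem riemannApply_tangentField (hg : IsMetricOn g O) (hψ : IsSmoothMapInto ψ W O) (hy : y ∈ W)
    (k l i j : Fin m) :
    riemannApply g (ψ y) (fun μ => tangentField ψ k μ y) (fun μ => tangentField ψ l μ y)
        (fun μ => tangentField ψ i μ y) (fun μ => tangentField ψ j μ y) =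
      pd i (lowerChristoffel g ψ k j l) y - pd j (lowerChristoffel g ψ k i l) y
      - scalarProd g (ψ y) (fun μ => covAlong g ψ (tangentField ψ l) j μ y)
          (fun μ => covAlong g ψ (tangentField ψ k) i μ y)
      + scalarProd g (ψ y) (fun μ => covAlong g ψ (tangentField ψ l) i μ y)
          (fun μ => covAlong g ψ (tangentField ψ k) j μ y) := by
  rw [riemannApply_eq_scalarProd]
  simp only [← covAlong_commutator hg hψ hy (hψ.smooth_tangentField l)]
  rw [hg.scalarProd_comm (hψ.mapsTo y hy), scalarProd_sub_left]
  have key : ∀ i j, pd i (lowerChristoffel g ψ k j l) y = _ := fun i j =>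
    pd_scalarProd_along hg hψ hy (smooth_covAlong hg hψ (hψ.smooth_tangentField l) j)
      (hψ.smooth_tangentField k) i
  rw [key, key]
  ring

end CovAlong

/-! ### The Riemann tensor and its symmetries -/

section Riemann

variable {d : ℕ} {g : MetricField d} {O : Set (Coord d)} {x : Coord d}

theorem IsMetricOn.isSmoothMapInto_id (hg : IsMetricOn g O) :
    IsSmoothMapInto (fun y : Coord d => y) O O :=
  ⟨hg.isOpen, fun μ => contDiff_apply ℝ ℝ μ |>.contDiffOn, fun _ h => h⟩

theorem tangentField_id (l μ : Fin d) (x : Coord d) :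
    tangentField (fun y : Coord d => y) l μ x = if l = μ then 1 else 0 := pd_coord l μ

theorem covAlong_id (Z : Fin d → Coord d → ℝ) (j μ : Fin d) (x : Coord d) :
    covAlong g (fun y => y) Z j μ x = pd j (Z μ) x + ∑ κ, christoffel g μ j κ x * Z κ x := by
  simp [covAlong, pd_coord]

theorem covAlong_tangentField_id (l j μ : Fin d) (x : Coord d) :
    covAlong g (fun y => y) (tangentField (fun y : Coord d => y) l) j μ x
      = christoffel g μ j l x := by
  have : tangentField (fun y : Coord d => y) l μ = fun _ => if l = μ then 1 else 0 :=
    funext fun _ => tangentField_id l μ _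
  rw [covAlong_id, this, pd_const]
  simp [tangentField_id]

theorem scalarProd_tangentField_id (k l : Fin d) :
    scalarProd g x (fun μ => tangentField (fun y : Coord d => y) k μ x)
      (fun μ => tangentField (fun y : Coord d => y) l μ x) = g x k l := by
  simp [scalarProd, tangentField_id]

theorem riemannApply_tangentField_id (k l i j : Fin d) :
    riemannApply g x (fun μ => tangentField (fun y : Coord d => y) k μ x)
      (fun μ => tangentField (fun y : Coord d => y) l μ x)
      (fun μ => tangentField (fun y : Coord d => y) i μ x)
      (fun μ => tangentField (fun y : Coord d => y) j μ x) = riemann g k l i j x := by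
  simp [riemannApply, tangentField_id]

theorem riemannUp_antisymm_last (ρ σ μ ν : Fin d) :
    riemannUp g ρ σ μ ν x = -riemannUp g ρ σ ν μ x := by
  simp only [riemannUp, Finset.sum_sub_distrib]
  ring

theorem riemann_antisymm_last (ρ σ μ ν : Fin d) :
    riemann g ρ σ μ ν x = -riemann g ρ σ ν μ x := by
  simp only [riemann, ← Finset.sum_neg_distrib]
  exact Finset.sum_congr rfl fun κ _ => by rw [riemannUp_antisymm_last]; ring

namespace IsMetricOn

theorem riemannUp_bianchi (hg : IsMetricOn g O) (hx : x ∈ O) (ρ σ μ ν : Fin d) :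
    riemannUp g ρ σ μ ν x + riemannUp g ρ μ ν σ x + riemannUp g ρ ν σ μ x = 0 := by
  have h : ∀ μ α β, pd μ (christoffel g ρ α β) x = pd μ (christoffel g ρ β α) x := fun μ α β =>
    pd_congr_of_eqOn hg.isOpen hx (fun y hy => hg.christoffel_symm hy ρ α β) μ
  simp only [riemannUp, Finset.sum_sub_distrib]
  rw [h μ σ ν, h ν σ μ, h σ μ ν]
  simp only [hg.christoffel_symm hx _ σ ν, hg.christoffel_symm hx _ σ μ,
    hg.christoffel_symm hx _ μ ν]
  ring

theorem riemann_bianchi (hg : IsMetricOn g O) (hx : x ∈ O) (ρ σ μ ν : Fin d) :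
    riemann g ρ σ μ ν x + riemann g ρ μ ν σ x + riemann g ρ ν σ μ x = 0 := by
  simp only [riemann, ← Finset.sum_add_distrib, ← mul_add, hg.riemannUp_bianchi hx, mul_zero,
    Finset.sum_const_zero]

/-- The antisymmetry in the first pair: second derivatives of the metric commute. -/
theorem riemann_antisymm_first (hg : IsMetricOn g O) (hx : x ∈ O) (ρ σ μ ν : Fin d) :
    riemann g ρ σ μ ν x = -riemann g σ ρ μ ν x := by
  have hid := hg.isSmoothMapInto_id
  have hs := hid.smooth_tangentField
  have hL : ∀ k j l, ContDiffOn ℝ ∞ (lowerChristoffel g (fun y : Coord d => y) k j l) O :=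
    fun k j l => smooth_scalarProd_along hg hid (smooth_covAlong hg hid (hs l) j) (hs k)
  have dL := fun k j l => differentiableAt_of_smoothOn hg.isOpen (hL k j l) hx
  have hsum : ∀ i j k l, pd i (lowerChristoffel g (fun y : Coord d => y) k j l) x +
      pd i (lowerChristoffel g (fun y : Coord d => y) l j k) x =
      pd i (pd j (fun y => g y k l)) x := by
    intro i j k l
    rw [← pd_add (dL _ _ _) (dL _ _ _)]
    refine pd_congr_of_eqOn hg.isOpen hx (fun y hy => ?_) i
    rw [lowerChristoffel_eq hg hid hy g (fun a b z _ => (scalarProd_tangentField_id a b).symm),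
      lowerChristoffel_eq hg hid hy g (fun a b z _ => (scalarProd_tangentField_id a b).symm),
      hg.pd_symm hy j l k]
    ring
  have hR := fun a b => riemannApply_tangentField hg hid hx a b μ ν
  simp only [riemannApply_tangentField_id] at hR
  rw [hR, hR, hg.scalarProd_comm hx (fun κ => covAlong g _ (tangentField _ ρ) ν κ x),
    hg.scalarProd_comm hx (fun κ => covAlong g _ (tangentField _ ρ) μ κ x)]
  linear_combination hsum μ ν ρ σ - hsum ν μ ρ σ + pd_comm hg.isOpen (hg.smooth ρ σ) hx μ ν

/-- The pair symmetry, a combination of four Bianchi identities. -/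
theorem riemann_pair_symm (hg : IsMetricOn g O) (hx : x ∈ O) (ρ σ μ ν : Fin d) :
    riemann g ρ σ μ ν x = riemann g μ ν ρ σ x := by
  have b := fun a b c e => hg.riemann_bianchi hx a b c e
  have f := fun a b c e => hg.riemann_antisymm_first hx a b c e
  have l := fun a b c e => riemann_antisymm_last (g := g) (x := x) a b c e
  linarith [b ρ σ μ ν, b σ μ ν ρ, b μ ν ρ σ, b ν ρ σ μ, f σ ρ μ ν, f μ ρ σ ν, f ν ρ σ μ,
    f ν σ μ ρ, f ν μ ρ σ, f σ μ ν ρ, l σ ν ρ μ, l ρ μ ν σ]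

end IsMetricOn

/-- The Riemann tensor of a metric in terms of its Christoffel symbols of the first kind. -/
theorem IsMetricOn.riemann_eq (hg : IsMetricOn g O) (hx : x ∈ O) (k l i j : Fin d) :
    riemann g k l i j x =
      pd i (lowerChristoffel g (fun y => y) k j l) x
      - pd j (lowerChristoffel g (fun y => y) k i l) x
      - scalarProd g x (fun μ => christoffel g μ j l x) (fun μ => christoffel g μ i k x)
      + scalarProd g x (fun μ => christoffel g μ i l x) (fun μ => christoffel g μ j k x) := by
  have h := riemannApply_tangentField hg hg.isSmoothMapInto_id hx k l i j
  rw [riemannApply_tangentField_id] at h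
  rw [h]
  simp only [covAlong_tangentField_id]

/-! ### Multilinearity of the curvature contraction -/

variable (g x)

theorem riemannApply_add₁ (a a' b c e : Coord d) : riemannApply g x (fun μ => a μ + a' μ) b c e =
    riemannApply g x a b c e + riemannApply g x a' b c e := by
  simp only [riemannApply, mul_add, add_mul, Finset.sum_add_distrib]

theorem riemannApply_add₂ (a b b' c e : Coord d) : riemannApply g x a (fun μ => b μ + b' μ) c e =
    riemannApply g x a b c e + riemannApply g x a b' c e := by
  simp only [riemannApply, mul_add, add_mul, Finset.sum_add_distrib]

theorem riemannApply_add₃ (a b c c' e : Coord d) : riemannApply g x a b (fun μ => c μ + c' μ) e =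
    riemannApply g x a b c e + riemannApply g x a b c' e := by
  simp only [riemannApply, mul_add, add_mul, Finset.sum_add_distrib]

theorem riemannApply_add₄ (a b c e e' : Coord d) : riemannApply g x a b c (fun μ => e μ + e' μ) =
    riemannApply g x a b c e + riemannApply g x a b c e' := by
  simp only [riemannApply, mul_add, Finset.sum_add_distrib]

theorem riemannApply_smul₁ (s : ℝ) (a b c e : Coord d) : riemannApply g x (fun μ => s * a μ) b c e =
    s * riemannApply g x a b c e := by
  simp only [riemannApply, Finset.mul_sum]
  exact Finset.sum_congr rfl fun _ _ => Finset.sum_congr rfl fun _ _ =>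
    Finset.sum_congr rfl fun _ _ => Finset.sum_congr rfl fun _ _ => by ring

theorem riemannApply_smul₂ (s : ℝ) (a b c e : Coord d) : riemannApply g x a (fun μ => s * b μ) c e =
    s * riemannApply g x a b c e := by
  simp only [riemannApply, Finset.mul_sum]
  exact Finset.sum_congr rfl fun _ _ => Finset.sum_congr rfl fun _ _ =>
    Finset.sum_congr rfl fun _ _ => Finset.sum_congr rfl fun _ _ => by ring

theorem riemannApply_smul₃ (s : ℝ) (a b c e : Coord d) : riemannApply g x a b (fun μ => s * c μ) e =
    s * riemannApply g x a b c e := by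
  simp only [riemannApply, Finset.mul_sum]
  exact Finset.sum_congr rfl fun _ _ => Finset.sum_congr rfl fun _ _ =>
    Finset.sum_congr rfl fun _ _ => Finset.sum_congr rfl fun _ _ => by ring

theorem riemannApply_smul₄ (s : ℝ) (a b c e : Coord d) : riemannApply g x a b c (fun μ => s * e μ) =
    s * riemannApply g x a b c e := by
  simp only [riemannApply, Finset.mul_sum]
  exact Finset.sum_congr rfl fun _ _ => Finset.sum_congr rfl fun _ _ =>
    Finset.sum_congr rfl fun _ _ => Finset.sum_congr rfl fun _ _ => by ring

theorem riemannApply_antisymm_last (a b c e : Coord d) :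
    riemannApply g x a b c e = -riemannApply g x a b e c := by
  simp only [riemannApply, ← Finset.sum_neg_distrib]
  refine Finset.sum_congr rfl fun _ _ => Finset.sum_congr rfl fun _ _ => ?_
  rw [Finset.sum_comm]
  refine Finset.sum_congr rfl fun _ _ => Finset.sum_congr rfl fun _ _ => ?_
  rw [riemann_antisymm_last]
  ring

variable {g x}

theorem IsMetricOn.riemannApply_antisymm_first (hg : IsMetricOn g O) (hx : x ∈ O)
    (a b c e : Coord d) : riemannApply g x a b c e = -riemannApply g x b a c e := by
  simp only [riemannApply, ← Finset.sum_neg_distrib]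
  rw [Finset.sum_comm]
  refine Finset.sum_congr rfl fun _ _ => Finset.sum_congr rfl fun _ _ =>
    Finset.sum_congr rfl fun _ _ => Finset.sum_congr rfl fun _ _ => ?_
  rw [hg.riemann_antisymm_first hx]
  ring

theorem IsMetricOn.riemannApply_pair_symm (hg : IsMetricOn g O) (hx : x ∈ O)
    (a b c e : Coord d) : riemannApply g x a b c e = riemannApply g x c e a b := by
  simp only [riemannApply]
  rw [sum_pull_third]
  refine Finset.sum_congr rfl fun γ _ => ?_
  rw [sum_pull_third]
  refine Finset.sum_congr rfl fun _ _ => Finset.sum_congr rfl fun _ _ =>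
    Finset.sum_congr rfl fun _ _ => ?_
  rw [hg.riemann_pair_symm hx]
  ring

end Riemann

/-! ### Covariant derivatives of forms and two-tensors -/

section Forms

variable {d : ℕ} {g : MetricField d} {O : Set (Coord d)} {x : Coord d}

/-- The covariant derivative `∇_σ Z^μ` of a vector field. -/
def nablaVec (g : MetricField d) (Z : Fin d → Coord d → ℝ) (σ μ : Fin d) (x : Coord d) : ℝ :=
  pd σ (Z μ) x + ∑ κ, christoffel g μ σ κ x * Z κ x

theorem nabla₁_congr (hO : IsOpen O) (hx : x ∈ O) {θ η : Fin d → Coord d → ℝ}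
    (h : ∀ y ∈ O, ∀ μ, θ μ y = η μ y) (σ ν : Fin d) : nabla₁ g θ σ ν x = nabla₁ g η σ ν x := by
  unfold nabla₁
  rw [pd_congr_of_eqOn hO hx (fun y hy => h y hy ν)]
  simp only [h x hx]

theorem nabla₂_congr (hO : IsOpen O) (hx : x ∈ O) {T S : Fin d → Fin d → Coord d → ℝ}
    (h : ∀ y ∈ O, ∀ μ ν, T μ ν y = S μ ν y) (σ μ ν : Fin d) :
    nabla₂ g T σ μ ν x = nabla₂ g S σ μ ν x := by
  unfold nabla₂
  rw [pd_congr_of_eqOn hO hx (fun y hy => h y hy μ ν)]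
  simp only [h x hx]

theorem smooth_nabla₁ (hg : IsMetricOn g O) {θ : Fin d → Coord d → ℝ}
    (hθ : ∀ μ, ContDiffOn ℝ ∞ (θ μ) O) (σ ν : Fin d) : ContDiffOn ℝ ∞ (nabla₁ g θ σ ν) O := by
  unfold nabla₁
  exact (smoothOn_pd hg.isOpen (hθ ν) σ).sub
    (ContDiffOn.sum fun κ _ => (hg.smooth_christoffel κ σ ν).mul (hθ κ))

/-- `∇_σ (f θ_ν) = ∂_σ f θ_ν + f ∇_σ θ_ν`. -/
theorem nabla₁_mul {f : Coord d → ℝ} {θ : Fin d → Coord d → ℝ} (hf : DifferentiableAt ℝ f x)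
    (hθ : ∀ μ, DifferentiableAt ℝ (θ μ) x) (σ ν : Fin d) :
    nabla₁ g (fun μ y => f y * θ μ y) σ ν x = pd σ f x * θ ν x + f x * nabla₁ g θ σ ν x := by
  unfold nabla₁
  rw [pd_mul hf (hθ ν), mul_sub, Finset.mul_sum]
  have : ∀ κ, christoffel g κ σ ν x * (f x * θ κ x) = f x * (christoffel g κ σ ν x * θ κ x) :=
    fun κ => by ring
  simp only [this]
  ring

theorem nabla₁_add {θ η : Fin d → Coord d → ℝ} (hθ : ∀ μ, DifferentiableAt ℝ (θ μ) x)
    (hη : ∀ μ, DifferentiableAt ℝ (η μ) x) (σ ν : Fin d) :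
    nabla₁ g (fun μ y => θ μ y + η μ y) σ ν x = nabla₁ g θ σ ν x + nabla₁ g η σ ν x := by
  unfold nabla₁
  rw [pd_add (hθ ν) (hη ν)]
  simp only [mul_add, Finset.sum_add_distrib]
  ring

/-- The Hessian of a function is symmetric. -/
theorem IsMetricOn.nabla₁_pd_comm (hg : IsMetricOn g O) (hx : x ∈ O) {f : Coord d → ℝ}
    (hf : ContDiffOn ℝ ∞ f O) (σ ν : Fin d) :
    nabla₁ g (fun μ => pd μ f) σ ν x = nabla₁ g (fun μ => pd μ f) ν σ x := by
  unfold nabla₁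
  rw [pd_comm hg.isOpen hf hx]
  simp only [hg.christoffel_symm hx _ σ ν]

theorem nabla₂_neg {T : Fin d → Fin d → Coord d → ℝ} (σ μ ν : Fin d) :
    nabla₂ g (fun μ ν y => -T μ ν y) σ μ ν x = -nabla₂ g T σ μ ν x := by
  unfold nabla₂
  rw [pd_neg]
  simp only [mul_neg, Finset.sum_neg_distrib]
  ring

theorem nabla₂_add {T S : Fin d → Fin d → Coord d → ℝ}
    (hT : ∀ μ ν, DifferentiableAt ℝ (T μ ν) x) (hS : ∀ μ ν, DifferentiableAt ℝ (S μ ν) x)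
    (σ μ ν : Fin d) :
    nabla₂ g (fun μ ν y => T μ ν y + S μ ν y) σ μ ν x =
      nabla₂ g T σ μ ν x + nabla₂ g S σ μ ν x := by
  unfold nabla₂
  rw [pd_add (hT μ ν) (hS μ ν)]
  simp only [mul_add, Finset.sum_add_distrib]
  ring

/-- The Leibniz rule for `θ ⊗ η`. -/
theorem nabla₂_mul {θ η : Fin d → Coord d → ℝ} (hθ : ∀ μ, DifferentiableAt ℝ (θ μ) x)
    (hη : ∀ μ, DifferentiableAt ℝ (η μ) x) (σ μ ν : Fin d) :
    nabla₂ g (fun μ ν y => θ μ y * η ν y) σ μ ν x =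
      nabla₁ g θ σ μ x * η ν x + θ μ x * nabla₁ g η σ ν x := by
  unfold nabla₂ nabla₁
  rw [pd_mul (hθ μ) (hη ν), sub_mul, mul_sub, Finset.mul_sum, Finset.sum_mul]
  have h1 : ∀ κ, christoffel g κ σ μ x * (θ κ x * η ν x) = christoffel g κ σ μ x * θ κ x * η ν x :=
    fun κ => by ring
  have h2 : ∀ κ, christoffel g κ σ ν x * (θ μ x * η κ x) =
      θ μ x * (christoffel g κ σ ν x * η κ x) := fun κ => by ring
  simp only [h1, h2]
  ring

/-- The Leibniz rule for the contraction `T_{νμ} Z^μ`. -/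
theorem nabla₁_contract {T : Fin d → Fin d → Coord d → ℝ} {Z : Fin d → Coord d → ℝ}
    (hT : ∀ μ ν, DifferentiableAt ℝ (T μ ν) x) (hZ : ∀ μ, DifferentiableAt ℝ (Z μ) x)
    (σ ν : Fin d) :
    nabla₁ g (fun ν y => ∑ μ, T ν μ y * Z μ y) σ ν x =
      ∑ μ, nabla₂ g T σ ν μ x * Z μ x + ∑ μ, T ν μ x * nablaVec g Z σ μ x := by
  unfold nabla₁ nabla₂ nablaVec
  rw [pd_sum (fun μ _ => by fun_prop)]
  have h1 : ∀ μ, pd σ (fun y => T ν μ y * Z μ y) x =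
    pd σ (T ν μ) x * Z μ x + T ν μ x * pd σ (Z μ) x := fun μ => pd_mul (hT ν μ) (hZ μ) σ
  have h2 : ∑ μ, (∑ κ, christoffel g κ σ μ x * T ν κ x) * Z μ x =
      ∑ μ, T ν μ x * ∑ κ, christoffel g μ σ κ x * Z κ x := by
    simp only [Finset.mul_sum, Finset.sum_mul]
    rw [Finset.sum_comm]
    exact Finset.sum_congr rfl fun _ _ => Finset.sum_congr rfl fun _ _ => by ring
  have h3 : ∑ κ, christoffel g κ σ ν x * ∑ μ, T κ μ x * Z μ x =
      ∑ μ, (∑ κ, christoffel g κ σ ν x * T κ μ x) * Z μ x := by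
    simp only [Finset.mul_sum, Finset.sum_mul]
    rw [Finset.sum_comm]
    exact Finset.sum_congr rfl fun _ _ => Finset.sum_congr rfl fun _ _ => by ring
  simp only [h1, h3, mul_add, sub_mul, Finset.sum_add_distrib, Finset.sum_sub_distrib]
  rw [h2]
  ring

/-- The Leibniz rule for the pairing `θ_μ Z^μ`. -/
theorem pd_pairing {θ Z : Fin d → Coord d → ℝ} (hθ : ∀ μ, DifferentiableAt ℝ (θ μ) x)
    (hZ : ∀ μ, DifferentiableAt ℝ (Z μ) x) (σ : Fin d) :
    pd σ (fun y => ∑ μ, θ μ y * Z μ y) x =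
      ∑ μ, nabla₁ g θ σ μ x * Z μ x + ∑ μ, θ μ x * nablaVec g Z σ μ x := by
  unfold nabla₁ nablaVec
  rw [pd_sum (fun μ _ => by fun_prop)]
  have h1 : ∀ μ, pd σ (fun y => θ μ y * Z μ y) x =
    pd σ (θ μ) x * Z μ x + θ μ x * pd σ (Z μ) x := fun μ => pd_mul (hθ μ) (hZ μ) σ
  have h2 : ∑ μ, (∑ κ, christoffel g κ σ μ x * θ κ x) * Z μ x =
      ∑ μ, θ μ x * ∑ κ, christoffel g μ σ κ x * Z κ x := by
    simp only [Finset.mul_sum, Finset.sum_mul]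
    rw [Finset.sum_comm]
    exact Finset.sum_congr rfl fun _ _ => Finset.sum_congr rfl fun _ _ => by ring
  simp only [h1, mul_add, sub_mul, Finset.sum_add_distrib, Finset.sum_sub_distrib]
  rw [h2]
  ring

theorem IsMetricOn.nabla₂_metric (hg : IsMetricOn g O) (hx : x ∈ O) (σ μ ν : Fin d) :
    nabla₂ g (fun μ ν y => g y μ ν) σ μ ν x = 0 := by
  unfold nabla₂
  rw [hg.pd_metric hx]
  simp only [hg.symm x hx _ ν, mul_comm (christoffel g _ _ _ x)]
  ring

/-- Lowering an index commutes with covariant differentiation. -/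
theorem IsMetricOn.nabla₁_lower (hg : IsMetricOn g O) (hx : x ∈ O) {Z : Fin d → Coord d → ℝ}
    (hZ : ∀ μ, DifferentiableAt ℝ (Z μ) x) (σ ν : Fin d) :
    nabla₁ g (fun ν y => ∑ μ, g y ν μ * Z μ y) σ ν x = ∑ μ, g x ν μ * nablaVec g Z σ μ x := by
  rw [nabla₁_contract (T := fun μ ν y => g y μ ν) (hg.differentiableAt hx) hZ]
  simp [hg.nabla₂_metric hx]

/-- The Ricci identity for one-forms. -/
theorem IsMetricOn.ricci_identity (hg : IsMetricOn g O) (hx : x ∈ O) {θ : Fin d → Coord d → ℝ}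
    (hθ : ∀ μ, ContDiffOn ℝ ∞ (θ μ) O) (σ μ ν : Fin d) :
    nabla₂ g (nabla₁ g θ) σ μ ν x - nabla₂ g (nabla₁ g θ) μ σ ν x =
      -∑ ρ, riemannUp g ρ ν σ μ x * θ ρ x := by
  have dθ := fun μ => differentiableAt_of_smoothOn hg.isOpen (hθ μ) hx
  have dθ' := fun μ ν => differentiableAt_of_smoothOn hg.isOpen (smoothOn_pd hg.isOpen (hθ μ) ν) hx
  have dC := fun μ α β =>
    differentiableAt_of_smoothOn hg.isOpen (hg.smooth_christoffel μ α β) hx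
  have e : ∀ σ μ, nabla₂ g (nabla₁ g θ) σ μ ν x =
      pd σ (pd μ (θ ν)) x - ∑ κ, pd σ (christoffel g κ μ ν) x * θ κ x
        - ∑ κ, christoffel g κ μ ν x * pd σ (θ κ) x
        - ∑ κ, christoffel g κ σ μ x * nabla₁ g θ κ ν x
        - ∑ κ, christoffel g κ σ ν x * pd μ (θ κ) x
        + ∑ ρ, (∑ κ, christoffel g κ σ ν x * christoffel g ρ μ κ x) * θ ρ x := by
    intro σ μ
    have h1 : pd σ (nabla₁ g θ μ ν) x = pd σ (pd μ (θ ν)) x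
        - ∑ κ, (pd σ (christoffel g κ μ ν) x * θ κ x + christoffel g κ μ ν x * pd σ (θ κ) x) := by
      unfold nabla₁
      rw [pd_sub (by fun_prop) (by fun_prop), pd_sum (fun κ _ => by fun_prop)]
      congr 1
      exact Finset.sum_congr rfl fun κ _ => pd_mul (dC _ _ _) (dθ _) _
    have h2 : ∑ κ, christoffel g κ σ ν x * nabla₁ g θ μ κ x =
        ∑ κ, christoffel g κ σ ν x * pd μ (θ κ) x -
        ∑ ρ, (∑ κ, christoffel g κ σ ν x * christoffel g ρ μ κ x) * θ ρ x := by
      simp only [nabla₁, mul_sub, Finset.sum_sub_distrib, Finset.mul_sum, Finset.sum_mul]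
      congr 1
      rw [Finset.sum_comm]
      exact Finset.sum_congr rfl fun _ _ => Finset.sum_congr rfl fun _ _ => by ring
    rw [nabla₂, h1, h2, Finset.sum_add_distrib]
    ring
  rw [e, e, pd_comm hg.isOpen (hθ ν) hx σ μ]
  simp only [hg.christoffel_symm hx _ μ σ]
  have hR : ∑ ρ, riemannUp g ρ ν σ μ x * θ ρ x =
      ∑ κ, pd σ (christoffel g κ μ ν) x * θ κ x - ∑ κ, pd μ (christoffel g κ σ ν) x * θ κ x
      + ∑ ρ, (∑ κ, christoffel g κ μ ν x * christoffel g ρ σ κ x) * θ ρ x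
      - ∑ ρ, (∑ κ, christoffel g κ σ ν x * christoffel g ρ μ κ x) * θ ρ x := by
    simp only [← Finset.sum_sub_distrib, ← Finset.sum_add_distrib]
    refine Finset.sum_congr rfl fun ρ _ => ?_
    simp only [riemannUp, Finset.sum_sub_distrib, mul_comm (christoffel g ρ _ _ x)]
    ring
  rw [hR]
  ring

/-! ### Contractions -/

/-- The contraction `T_{μν} a^μ b^ν`. -/
def contract₂ (T : Fin d → Fin d → ℝ) (a b : Coord d) : ℝ := ∑ μ, ∑ ν, a μ * b ν * T μ ν

/-- The contraction `T_{σμν} a^σ b^μ c^ν`. -/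
def contract₃ (T : Fin d → Fin d → Fin d → ℝ) (a b c : Coord d) : ℝ :=
  ∑ σ, ∑ μ, ∑ ν, a σ * b μ * c ν * T σ μ ν

theorem contract₃_eq_contract₂_first (T : Fin d → Fin d → Fin d → ℝ) (a b c : Coord d) :
    contract₃ T a b c = contract₂ (fun μ ν => ∑ σ, a σ * T σ μ ν) b c := by
  simp only [contract₃, contract₂, Finset.mul_sum]
  rw [← sum_pull_third]
  exact Finset.sum_congr rfl fun _ _ => Finset.sum_congr rfl fun _ _ =>
    Finset.sum_congr rfl fun _ _ => by ring

theorem contract₃_eq_contract₂_second (T : Fin d → Fin d → Fin d → ℝ) (a b c : Coord d) :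
    contract₃ T a b c = contract₂ (fun σ ν => ∑ μ, T σ μ ν * b μ) a c := by
  simp only [contract₃, contract₂, Finset.mul_sum]
  refine Finset.sum_congr rfl fun _ _ => ?_
  rw [Finset.sum_comm]
  exact Finset.sum_congr rfl fun _ _ => Finset.sum_congr rfl fun _ _ => by ring

theorem contract₂_mul (θ η a b : Coord d) :
    contract₂ (fun μ ν => θ μ * η ν) a b = (∑ μ, a μ * θ μ) * ∑ ν, b ν * η ν := by
  simp only [contract₂, Finset.sum_mul_sum]
  exact Finset.sum_congr rfl fun _ _ => Finset.sum_congr rfl fun _ _ => by ring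

theorem contract₂_add (T S : Fin d → Fin d → ℝ) (a b : Coord d) :
    contract₂ (fun μ ν => T μ ν + S μ ν) a b = contract₂ T a b + contract₂ S a b := by
  simp only [contract₂, mul_add, Finset.sum_add_distrib]

theorem contract₂_neg (T : Fin d → Fin d → ℝ) (a b : Coord d) :
    contract₂ (fun μ ν => -T μ ν) a b = -contract₂ T a b := by
  simp only [contract₂, mul_neg, Finset.sum_neg_distrib]

theorem contract₂_smul (s : ℝ) (T : Fin d → Fin d → ℝ) (a b : Coord d) :
    contract₂ (fun μ ν => s * T μ ν) a b = s * contract₂ T a b := by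
  simp only [contract₂, Finset.mul_sum]
  exact Finset.sum_congr rfl fun _ _ => Finset.sum_congr rfl fun _ _ => by ring

theorem contract₂_comm (T : Fin d → Fin d → ℝ) (a b : Coord d) :
    contract₂ T a b = contract₂ (fun μ ν => T ν μ) b a := by
  unfold contract₂
  rw [Finset.sum_comm]
  exact Finset.sum_congr rfl fun _ _ => Finset.sum_congr rfl fun _ _ => by ring

theorem contract₂_eq_left (T : Fin d → Fin d → ℝ) (a b : Coord d) :
    contract₂ T a b = ∑ ν, b ν * ∑ μ, a μ * T μ ν := by
  simp only [contract₂, Finset.mul_sum]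
  rw [Finset.sum_comm]
  exact Finset.sum_congr rfl fun _ _ => Finset.sum_congr rfl fun _ _ => by ring

theorem contract₂_eq_right (T : Fin d → Fin d → ℝ) (a b : Coord d) :
    contract₂ T a b = ∑ μ, a μ * ∑ ν, b ν * T μ ν := by
  simp only [contract₂, Finset.mul_sum]
  exact Finset.sum_congr rfl fun _ _ => Finset.sum_congr rfl fun _ _ => by ring

theorem contract₃_mul_first_second (T : Fin d → Fin d → ℝ) (θ a b c : Coord d) :
    contract₃ (fun σ μ ν => T σ μ * θ ν) a b c = contract₂ T a b * ∑ ν, c ν * θ ν := by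
  simp only [contract₃, contract₂, Finset.sum_mul, Finset.mul_sum]
  rw [sum_pull_third]
  exact Finset.sum_congr rfl fun _ _ => Finset.sum_congr rfl fun _ _ =>
    Finset.sum_congr rfl fun _ _ => by ring

theorem contract₃_mul_first_third (T : Fin d → Fin d → ℝ) (θ a b c : Coord d) :
    contract₃ (fun σ μ ν => θ μ * T σ ν) a b c = (∑ μ, b μ * θ μ) * contract₂ T a c := by
  simp only [contract₃, contract₂, Finset.sum_mul, Finset.mul_sum]
  refine Finset.sum_congr rfl fun _ _ => ?_
  rw [Finset.sum_comm]
  exact Finset.sum_congr rfl fun _ _ => Finset.sum_congr rfl fun _ _ => by ring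

theorem contract₃_add (T S : Fin d → Fin d → Fin d → ℝ) (a b c : Coord d) :
    contract₃ (fun σ μ ν => T σ μ ν + S σ μ ν) a b c = contract₃ T a b c + contract₃ S a b c := by
  simp only [contract₃, mul_add, Finset.sum_add_distrib]

theorem contract₃_neg (T : Fin d → Fin d → Fin d → ℝ) (a b c : Coord d) :
    contract₃ (fun σ μ ν => -T σ μ ν) a b c = -contract₃ T a b c := by
  simp only [contract₃, mul_neg, Finset.sum_neg_distrib]

theorem contract₃_swap (T : Fin d → Fin d → Fin d → ℝ) (a b c : Coord d) :
    contract₃ (fun σ μ ν => T μ σ ν) a b c = contract₃ T b a c := by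
  simp only [contract₃]
  rw [Finset.sum_comm]
  exact Finset.sum_congr rfl fun _ _ => Finset.sum_congr rfl fun _ _ =>
    Finset.sum_congr rfl fun _ _ => by ring

/-- The contraction of the curvature with a vector `Z` and three further vectors, as the
antisymmetrized second covariant derivative of the one-form `Z_μ`. -/
theorem IsMetricOn.riemannApply_eq_contract₃ (hg : IsMetricOn g O) (hx : x ∈ O)
    {θ : Fin d → Coord d → ℝ} (hθ : ∀ μ, ContDiffOn ℝ ∞ (θ μ) O) {Z : Coord d}
    (hZ : ∀ μ, ∑ ν, g x μ ν * Z ν = θ μ x) (a b c : Coord d) :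
    riemannApply g x Z c a b =
      contract₃ (fun σ μ ν => nabla₂ g (nabla₁ g θ) σ μ ν x) b a c
        - contract₃ (fun σ μ ν => nabla₂ g (nabla₁ g θ) σ μ ν x) a b c := by
  rw [← contract₃_swap, sub_eq_add_neg, ← contract₃_neg, ← contract₃_add]
  have h := fun σ μ ν => hg.ricci_identity hx hθ μ σ ν
  simp only [sub_eq_add_neg] at h
  simp only [h]
  have hR : ∀ δ θ' σ, ∑ ρ, riemann g ρ δ θ' σ x * Z ρ = ∑ ρ, riemannUp g ρ δ θ' σ x * θ ρ x := by
    intro δ θ' σ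
    simp only [riemann, Finset.sum_mul, ← hZ, Finset.mul_sum]
    rw [Finset.sum_comm]
    refine Finset.sum_congr rfl fun _ _ => Finset.sum_congr rfl fun _ _ => ?_
    rw [hg.symm x hx]
    ring
  have h' : ∀ σ μ ν, -∑ ρ, riemannUp g ρ ν μ σ x * θ ρ x = ∑ ρ, riemann g ρ ν σ μ x * Z ρ := by
    intro σ μ ν
    rw [hR, ← Finset.sum_neg_distrib]
    refine Finset.sum_congr rfl fun ρ _ => ?_
    rw [riemannUp_antisymm_last]
    ring
  simp only [h', riemannApply, contract₃, Finset.mul_sum]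
  calc _ = ∑ α, ∑ β, ∑ σ, ∑ ρ, riemann g ρ α β σ x * Z ρ * c α * a β * b σ :=
        (sum_pull_fourth _).symm
    _ = _ := by
        rw [← sum_pull_third]
        exact Finset.sum_congr rfl fun _ _ => Finset.sum_congr rfl fun _ _ =>
          Finset.sum_congr rfl fun _ _ => Finset.sum_congr rfl fun _ _ => by ring

end Forms

/-! ### The unit normal and the extrinsic curvature -/

section Slicing

variable {g : MetricField 4} {t : Coord 4 → ℝ} {U : Set (Coord 4)} {x : Coord 4}

/-- The acceleration `a_ρ = n^σ ∇_σ n_ρ` of the unit normal. -/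
def accel (g : MetricField 4) (t : Coord 4 → ℝ) (ρ : Fin 4) (x : Coord 4) : ℝ :=
  ∑ σ, normal g t σ x * nabla₁ g (normalForm g t) σ ρ x

/-- The column `γ^σ_μ`, for fixed `μ`, of the projector, as a vector. -/
def projVec (g : MetricField 4) (t : Coord 4 → ℝ) (x : Coord 4) (μ : Fin 4) : Coord 4 :=
  fun σ => proj g t σ μ x

theorem smooth_lapse (hg : IsMetricOn g U) (ht : IsTimeFunctionOn g t U) :
    ContDiffOn ℝ ∞ (lapse g t) U := by
  have hN : ContDiffOn ℝ ∞ (fun x => -∑ μ, ∑ ν, (g x)⁻¹ μ ν * pd μ t x * pd ν t x) U :=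
    (ContDiffOn.sum fun μ _ => ContDiffOn.sum fun ν _ =>
      ((hg.smooth_inv μ ν).mul (smoothOn_pd hg.isOpen ht.smooth μ)).mul
        (smoothOn_pd hg.isOpen ht.smooth ν)).neg
  have hpos : ∀ x ∈ U, 0 < -∑ μ, ∑ ν, (g x)⁻¹ μ ν * pd μ t x * pd ν t x :=
    fun x hx => neg_pos.2 (ht.timelike x hx)
  exact (hN.sqrt fun x hx => (hpos x hx).ne').inv fun x hx => (Real.sqrt_pos.2 (hpos x hx)).ne'

theorem lapse_pos (ht : IsTimeFunctionOn g t U) (hx : x ∈ U) : 0 < lapse g t x :=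
  inv_pos.2 (Real.sqrt_pos.2 (neg_pos.2 (ht.timelike x hx)))

theorem smooth_normalForm (hg : IsMetricOn g U) (ht : IsTimeFunctionOn g t U) (μ : Fin 4) :
    ContDiffOn ℝ ∞ (normalForm g t μ) U :=
  (smooth_lapse hg ht).neg.mul (smoothOn_pd hg.isOpen ht.smooth μ)

theorem smooth_normal (hg : IsMetricOn g U) (ht : IsTimeFunctionOn g t U) (μ : Fin 4) :
    ContDiffOn ℝ ∞ (normal g t μ) U :=
  ContDiffOn.sum fun ν _ => (hg.smooth_inv μ ν).mul (smooth_normalForm hg ht ν)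

theorem smooth_proj (hg : IsMetricOn g U) (ht : IsTimeFunctionOn g t U) (μ ν : Fin 4) :
    ContDiffOn ℝ ∞ (proj g t μ ν) U :=
  contDiffOn_const.add ((smooth_normal hg ht μ).mul (smooth_normalForm hg ht ν))

theorem smooth_extrinsic (hg : IsMetricOn g U) (ht : IsTimeFunctionOn g t U) (μ ν : Fin 4) :
    ContDiffOn ℝ ∞ (extrinsic g t μ ν) U :=
  (ContDiffOn.sum fun σ _ => ContDiffOn.sum fun ρ _ =>
    ((smooth_proj hg ht σ μ).mul (smooth_proj hg ht ρ ν)).mul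
      (smooth_nabla₁ hg (smooth_normalForm hg ht) σ ρ)).neg

theorem smooth_accel (hg : IsMetricOn g U) (ht : IsTimeFunctionOn g t U) (ρ : Fin 4) :
    ContDiffOn ℝ ∞ (accel g t ρ) U :=
  ContDiffOn.sum fun σ _ => (smooth_normal hg ht σ).mul
    (smooth_nabla₁ hg (smooth_normalForm hg ht) σ ρ)

theorem lower_normal (hg : IsMetricOn g U) (hx : x ∈ U) (μ : Fin 4) :
    ∑ ν, g x μ ν * normal g t ν x = normalForm g t μ x :=
  hg.lower_raise hx (fun ν => normalForm g t ν x) μ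

/-- The normal is a unit timelike vector. -/
theorem normal_unit (ht : IsTimeFunctionOn g t U) (hx : x ∈ U) :
    ∑ μ, normal g t μ x * normalForm g t μ x = -1 := by
  have hpos : 0 < -∑ μ, ∑ ν, (g x)⁻¹ μ ν * pd μ t x * pd ν t x := neg_pos.2 (ht.timelike x hx)
  have hl : lapse g t x ^ 2 * (-∑ μ, ∑ ν, (g x)⁻¹ μ ν * pd μ t x * pd ν t x) = 1 := by
    rw [lapse, inv_pow, Real.sq_sqrt hpos.le, inv_mul_cancel₀ hpos.ne']
  have : ∑ μ, normal g t μ x * normalForm g t μ x =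
      lapse g t x ^ 2 * ∑ μ, ∑ ν, (g x)⁻¹ μ ν * pd μ t x * pd ν t x := by
    simp only [normal, normalForm, Finset.mul_sum, Finset.sum_mul]
    exact Finset.sum_congr rfl fun _ _ => Finset.sum_congr rfl fun _ _ => by ring
  rw [this]
  linarith

theorem sum_projVec_mul (μ : Fin 4) (θ : Coord 4) :
    ∑ σ, projVec g t x μ σ * θ σ = θ μ + normalForm g t μ x * ∑ σ, normal g t σ x * θ σ := by
  simp only [projVec, proj, add_mul, Finset.sum_add_distrib, ite_mul, one_mul, zero_mul,
    Finset.sum_ite_eq', Finset.mem_univ, if_true, Finset.mul_sum]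
  congr 1
  exact Finset.sum_congr rfl fun _ _ => by ring

theorem projVec_normalForm (ht : IsTimeFunctionOn g t U) (hx : x ∈ U) (μ : Fin 4) :
    ∑ σ, projVec g t x μ σ * normalForm g t σ x = 0 := by
  rw [sum_projVec_mul, normal_unit ht hx]
  ring

theorem contract₂_projVec (T : Fin 4 → Fin 4 → ℝ) (μ ν : Fin 4) :
    contract₂ T (projVec g t x μ) (projVec g t x ν) =
      T μ ν + normalForm g t μ x * (∑ σ, normal g t σ x * T σ ν)
        + normalForm g t ν x * (∑ ρ, normal g t ρ x * T μ ρ)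
        + normalForm g t μ x * normalForm g t ν x *
          ∑ σ, normal g t σ x * ∑ ρ, normal g t ρ x * T σ ρ := by
  rw [contract₂_eq_right, sum_projVec_mul]
  simp only [sum_projVec_mul, mul_add, Finset.sum_add_distrib]
  have : ∀ σ, normal g t σ x * (normalForm g t ν x * ∑ ρ, normal g t ρ x * T σ ρ) =
      normalForm g t ν x * (normal g t σ x * ∑ ρ, normal g t ρ x * T σ ρ) := fun σ => by ring
  simp only [this, ← Finset.mul_sum]
  ring

theorem nabla₁_normalForm (hg : IsMetricOn g U) (ht : IsTimeFunctionOn g t U) (hx : x ∈ U)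
    (σ ν : Fin 4) :
    nabla₁ g (normalForm g t) σ ν x = ∑ μ, g x ν μ * nablaVec g (normal g t) σ μ x := by
  rw [← hg.nabla₁_lower hx
    (fun μ => differentiableAt_of_smoothOn hg.isOpen (smooth_normal hg ht μ) hx)]
  exact nabla₁_congr hg.isOpen hx (fun y hy μ => (lower_normal hg hy μ).symm) σ ν

theorem nablaVec_normal (hg : IsMetricOn g U) (ht : IsTimeFunctionOn g t U) (hx : x ∈ U)
    (σ μ : Fin 4) : nablaVec g (normal g t) σ μ x =
      ∑ ν, (g x)⁻¹ μ ν * nabla₁ g (normalForm g t) σ ν x := by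
  simp only [nabla₁_normalForm hg ht hx]
  exact (hg.raise_lower hx (fun ν => nablaVec g (normal g t) σ ν x) μ).symm

/-- Since `n` has constant norm, `n^ρ ∇_σ n_ρ = 0`. -/
theorem normal_nabla₁_normalForm (hg : IsMetricOn g U) (ht : IsTimeFunctionOn g t U) (hx : x ∈ U)
    (σ : Fin 4) : ∑ ρ, normal g t ρ x * nabla₁ g (normalForm g t) σ ρ x = 0 := by
  have h := pd_pairing (g := g) (x := x)
    (fun μ => differentiableAt_of_smoothOn hg.isOpen (smooth_normalForm hg ht μ) hx)
    (fun μ => differentiableAt_of_smoothOn hg.isOpen (smooth_normal hg ht μ) hx) σ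
  rw [pd_congr_of_eqOn hg.isOpen hx (h := fun _ => -1) (fun y hy => by
    rw [← normal_unit ht hy]; exact Finset.sum_congr rfl fun _ _ => mul_comm _ _), pd_const] at h
  have h2 : ∑ μ, normalForm g t μ x * nablaVec g (normal g t) σ μ x =
      ∑ ρ, nabla₁ g (normalForm g t) σ ρ x * normal g t ρ x := by
    simp only [nablaVec_normal hg ht hx, normal, Finset.mul_sum]
    rw [Finset.sum_comm]
    refine Finset.sum_congr rfl fun _ _ => Finset.sum_congr rfl fun _ _ => ?_
    rw [hg.inv_symm hx]
    ring
  rw [h2] at h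
  simp only [mul_comm (normal g t _ x)]
  linarith

theorem normal_accel (hg : IsMetricOn g U) (ht : IsTimeFunctionOn g t U) (hx : x ∈ U) :
    ∑ ρ, normal g t ρ x * accel g t ρ x = 0 := by
  simp only [accel, Finset.mul_sum]
  rw [Finset.sum_comm]
  refine Finset.sum_eq_zero fun σ _ => ?_
  have := normal_nabla₁_normalForm hg ht hx σ
  calc _ = normal g t σ x * ∑ ρ, normal g t ρ x * nabla₁ g (normalForm g t) σ ρ x := by
        rw [Finset.mul_sum]
        exact Finset.sum_congr rfl fun _ _ => by ring
    _ = 0 := by rw [this, mul_zero]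

/-- The splitting `∇_σ n_ρ = -K_{σρ} - n_σ a_ρ` of the gradient of the normal into extrinsic
curvature and acceleration. It holds on all of `U`, so it may be differentiated. -/
theorem nabla₁_normalForm_eq (hg : IsMetricOn g U) (ht : IsTimeFunctionOn g t U) (hx : x ∈ U)
    (σ ρ : Fin 4) : nabla₁ g (normalForm g t) σ ρ x =
      -(extrinsic g t σ ρ x + normalForm g t σ x * accel g t ρ x) := by
  have h : extrinsic g t σ ρ x = -contract₂ (fun μ ν => nabla₁ g (normalForm g t) μ ν x)
      (projVec g t x σ) (projVec g t x ρ) := rfl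
  rw [h, contract₂_projVec]
  simp only [normal_nabla₁_normalForm hg ht hx, accel]
  simp

/-- `∂_ρ α + n_ρ n^σ ∂_σ α = α a_ρ`: as `n` is proportional to `dt`, the antisymmetric part of
`∇ n` comes from the gradient of the lapse alone. -/
theorem lapse_mul_accel (hg : IsMetricOn g U) (ht : IsTimeFunctionOn g t U) (hx : x ∈ U)
    (ρ : Fin 4) : lapse g t x * accel g t ρ x =
      pd ρ (lapse g t) x + (∑ σ, normal g t σ x * pd σ (lapse g t) x) * normalForm g t ρ x := by
  have hB : ∀ σ, lapse g t x * nabla₁ g (normalForm g t) σ ρ x =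
      lapse g t x * nabla₁ g (normalForm g t) ρ σ x
        + pd σ (lapse g t) x * normalForm g t ρ x - pd ρ (lapse g t) x * normalForm g t σ x := by
    intro σ
    have dl : DifferentiableAt ℝ (fun y => -lapse g t y) x :=
      (differentiableAt_of_smoothOn hg.isOpen (smooth_lapse hg ht) hx).neg
    have dt := fun μ =>
      differentiableAt_of_smoothOn hg.isOpen (smoothOn_pd hg.isOpen ht.smooth μ) hx
    have e : ∀ σ ρ, nabla₁ g (normalForm g t) σ ρ x =
        -pd σ (lapse g t) x * pd ρ t x + -lapse g t x * nabla₁ g (fun μ => pd μ t) σ ρ x := by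
      intro σ ρ
      have := nabla₁_mul (g := g) dl dt σ ρ
      rw [pd_neg] at this
      exact this
    rw [e, e, hg.nabla₁_pd_comm hx ht.smooth σ ρ, normalForm, normalForm]
    ring
  rw [accel, Finset.mul_sum]
  have : ∀ σ, lapse g t x * (normal g t σ x * nabla₁ g (normalForm g t) σ ρ x) =
      lapse g t x * (normal g t σ x * nabla₁ g (normalForm g t) ρ σ x)
        + normal g t σ x * pd σ (lapse g t) x * normalForm g t ρ x
        - pd ρ (lapse g t) x * (normal g t σ x * normalForm g t σ x) := fun σ => by
    linear_combination normal g t σ x * hB σ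
  simp only [this, Finset.sum_add_distrib, Finset.sum_sub_distrib, ← Finset.mul_sum,
    ← Finset.sum_mul, normal_unit ht hx, normal_nabla₁_normalForm hg ht hx]
  ring

/-- The acceleration is the logarithmic gradient of the lapse. -/
theorem spatialGradLapse_eq (hg : IsMetricOn g U) (ht : IsTimeFunctionOn g t U) (hx : x ∈ U)
    (μ : Fin 4) : spatialGradLapse g t μ x = lapse g t x * accel g t μ x := by
  rw [lapse_mul_accel hg ht hx]
  exact (sum_projVec_mul μ (fun σ => pd σ (lapse g t) x)).trans (by ring)

theorem extrinsic_symm (hg : IsMetricOn g U) (ht : IsTimeFunctionOn g t U) (hx : x ∈ U)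
    (μ ν : Fin 4) : extrinsic g t μ ν x = extrinsic g t ν μ x := by
  have dl : DifferentiableAt ℝ (fun y => -lapse g t y) x :=
    (differentiableAt_of_smoothOn hg.isOpen (smooth_lapse hg ht) hx).neg
  have dt := fun μ => differentiableAt_of_smoothOn hg.isOpen (smoothOn_pd hg.isOpen ht.smooth μ) hx
  have e : ∀ σ ρ, nabla₁ g (normalForm g t) σ ρ x =
      (lapse g t x)⁻¹ * (pd σ (lapse g t) x * normalForm g t ρ x)
        + -lapse g t x * nabla₁ g (fun μ => pd μ t) σ ρ x := by
    intro σ ρ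
    have := nabla₁_mul (g := g) dl dt σ ρ
    rw [pd_neg] at this
    have hl := (lapse_pos ht hx).ne'
    refine this.trans ?_
    rw [normalForm]
    field_simp
  -- the gradient term of `∇ n` is proportional to `n` and projects to zero
  have h : ∀ μ ν, extrinsic g t μ ν x = lapse g t x *
      contract₂ (fun σ ρ => nabla₁ g (fun μ => pd μ t) σ ρ x) (projVec g t x μ)
        (projVec g t x ν) := by
    intro μ ν
    have h : extrinsic g t μ ν x = -contract₂ (fun μ ν => nabla₁ g (normalForm g t) μ ν x)
      (projVec g t x μ) (projVec g t x ν) := rfl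
    simp only [h, e, contract₂_add, contract₂_smul, contract₂_mul, projVec_normalForm ht hx]
    ring
  rw [h, h, contract₂_comm]
  simp only [hg.nabla₁_pd_comm hx ht.smooth]

theorem normal_extrinsic (hg : IsMetricOn g U) (ht : IsTimeFunctionOn g t U) (hx : x ∈ U)
    (ν : Fin 4) : ∑ μ, extrinsic g t ν μ x * normal g t μ x = 0 := by
  have h : ∀ μ, extrinsic g t ν μ x * normal g t μ x =
      -(normal g t μ x * nabla₁ g (normalForm g t) ν μ x)
        - normalForm g t ν x * (normal g t μ x * accel g t μ x) := fun μ => by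
    rw [nabla₁_normalForm_eq hg ht hx]; ring
  simp only [h, Finset.sum_sub_distrib, Finset.sum_neg_distrib, ← Finset.mul_sum,
    normal_nabla₁_normalForm hg ht hx, normal_accel hg ht hx]
  simp

theorem projVec_extrinsic (hg : IsMetricOn g U) (ht : IsTimeFunctionOn g t U) (hx : x ∈ U)
    (μ ν : Fin 4) : ∑ σ, projVec g t x μ σ * extrinsic g t ν σ x = extrinsic g t ν μ x := by
  have := normal_extrinsic hg ht hx ν
  simp only [mul_comm (extrinsic g t ν _ x)] at this
  rw [sum_projVec_mul, this, mul_zero, add_zero]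

theorem projVec_accel (hg : IsMetricOn g U) (ht : IsTimeFunctionOn g t U) (hx : x ∈ U)
    (μ : Fin 4) : ∑ σ, projVec g t x μ σ * accel g t σ x = accel g t μ x := by
  rw [sum_projVec_mul, normal_accel hg ht hx, mul_zero, add_zero]

/-! ### The Codazzi relation -/

/-- The contraction of `∇_σ ∇_μ n_ν` with three vectors, from the Leibniz rule applied to
`∇_μ n_ν = -K_{μν} - n_μ a_ν`. -/
theorem contract₃_nabla₂_nabla₁_normalForm (hg : IsMetricOn g U) (ht : IsTimeFunctionOn g t U)
    (hx : x ∈ U) (a b c : Coord 4) :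
    contract₃ (fun σ μ ν => nabla₂ g (nabla₁ g (normalForm g t)) σ μ ν x) a b c =
      -(contract₃ (fun σ μ ν => nabla₂ g (extrinsic g t) σ μ ν x) a b c
        + (contract₂ (fun σ μ => nabla₁ g (normalForm g t) σ μ x) a b * (∑ ν, c ν * accel g t ν x)
        + (∑ μ, b μ * normalForm g t μ x) *
          contract₂ (fun σ ν => nabla₁ g (accel g t) σ ν x) a c)) := by
  have dn := fun μ => differentiableAt_of_smoothOn hg.isOpen (smooth_normalForm hg ht μ) hx
  have da := fun μ => differentiableAt_of_smoothOn hg.isOpen (smooth_accel hg ht μ) hx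
  have dK := fun μ ν => differentiableAt_of_smoothOn hg.isOpen (smooth_extrinsic hg ht μ ν) hx
  have h : ∀ σ μ ν, nabla₂ g (nabla₁ g (normalForm g t)) σ μ ν x =
      -(nabla₂ g (extrinsic g t) σ μ ν x
        + (nabla₁ g (normalForm g t) σ μ x * accel g t ν x
          + normalForm g t μ x * nabla₁ g (accel g t) σ ν x)) := by
    intro σ μ ν
    rw [nabla₂_congr hg.isOpen hx (fun y hy => nabla₁_normalForm_eq hg ht hy), nabla₂_neg,
      nabla₂_add (S := fun μ ν y => normalForm g t μ y * accel g t ν y) dK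
        (fun μ ν => (dn μ).mul (da ν)), nabla₂_mul dn da]
  simp only [h, contract₃_neg, contract₃_add]
  rw [contract₃_mul_first_second, contract₃_mul_first_third]

/-- The Ricci identity for `n`, projected onto the slice: the acceleration terms cancel because
`K` is symmetric. -/
theorem codazzi_relation (hg : IsMetricOn g U) (ht : IsTimeFunctionOn g t U) (hx : x ∈ U)
    (μ α β : Fin 4) : codazziProj g t μ α β x =
      spatialDerivK g t α μ β x - spatialDerivK g t μ α β x := by
  have h1 : codazziProj g t μ α β x = riemannApply g x (fun ρ => normal g t ρ x)
    (projVec g t x β) (projVec g t x α) (projVec g t x μ) := rfl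
  have h2 : ∀ α μ β, spatialDerivK g t α μ β x =
    contract₃ (fun σ μ ν => nabla₂ g (extrinsic g t) σ μ ν x) (projVec g t x α) (projVec g t x μ)
      (projVec g t x β) := fun _ _ _ => rfl
  have hB : ∀ a b, contract₂ (fun σ μ => nabla₁ g (normalForm g t) σ μ x) (projVec g t x a)
      (projVec g t x b) = -extrinsic g t a b x := fun a b => (neg_neg _).symm
  rw [h1, h2, h2, hg.riemannApply_eq_contract₃ hx (smooth_normalForm hg ht)
    (lower_normal hg hx)]
  simp only [contract₃_nabla₂_nabla₁_normalForm hg ht hx, projVec_normalForm ht hx, hB]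
  rw [extrinsic_symm hg ht hx μ α]
  ring

/-! ### The Ricci relation -/

/-- The derivative of the identity `K_{νσ} n^σ = 0`. -/
theorem nabla₂_extrinsic_normal (hg : IsMetricOn g U) (ht : IsTimeFunctionOn g t U) (hx : x ∈ U)
    (κ ν : Fin 4) : ∑ σ, nabla₂ g (extrinsic g t) κ ν σ x * normal g t σ x =
      -∑ σ, extrinsic g t ν σ x * nablaVec g (normal g t) κ σ x := by
  have h := nabla₁_contract (g := g) (T := extrinsic g t) (Z := normal g t)
    (fun μ ν => differentiableAt_of_smoothOn hg.isOpen (smooth_extrinsic hg ht μ ν) hx)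
    (fun μ => differentiableAt_of_smoothOn hg.isOpen (smooth_normal hg ht μ) hx) κ ν
  rw [nabla₁_congr hg.isOpen hx (θ := fun ν y => ∑ μ, extrinsic g t ν μ y * normal g t μ y)
    (η := fun _ _ => 0) (fun y hy μ => normal_extrinsic hg ht hy μ)] at h
  have h0 : nabla₁ g (fun _ _ => 0) κ ν x = 0 := by simp [nabla₁, pd_const]
  linarith

theorem nabla₂_extrinsic_symm (hg : IsMetricOn g U) (ht : IsTimeFunctionOn g t U) (hx : x ∈ U)
    (κ μ ν : Fin 4) : nabla₂ g (extrinsic g t) κ μ ν x = nabla₂ g (extrinsic g t) κ ν μ x := by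
  rw [nabla₂_congr hg.isOpen hx (S := fun μ ν y => extrinsic g t ν μ y)
    (fun y hy => extrinsic_symm hg ht hy)]
  simp only [nabla₂]
  ring

/-- `K^ρ_μ K_{νρ}`, the square of the extrinsic curvature. -/
def extrinsicSq (g : MetricField 4) (t : Coord 4 → ℝ) (μ ν : Fin 4) (x : Coord 4) : ℝ :=
  ∑ ρ, ∑ σ, (g x)⁻¹ ρ σ * extrinsic g t σ μ x * extrinsic g t ν ρ x

/-- `K_{μσ} a^σ`. -/
def extrinsicAccel (g : MetricField 4) (t : Coord 4 → ℝ) (μ : Fin 4) (x : Coord 4) : ℝ :=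
  ∑ σ, extrinsic g t μ σ x * ∑ ρ, (g x)⁻¹ σ ρ * accel g t ρ x

theorem extrinsicSq_symm (hg : IsMetricOn g U) (ht : IsTimeFunctionOn g t U) (hx : x ∈ U)
    (μ ν : Fin 4) : extrinsicSq g t μ ν x = extrinsicSq g t ν μ x := by
  unfold extrinsicSq
  rw [Finset.sum_comm]
  refine Finset.sum_congr rfl fun ρ _ => Finset.sum_congr rfl fun σ _ => ?_
  rw [hg.inv_symm hx, extrinsic_symm hg ht hx ρ μ, extrinsic_symm hg ht hx ν σ]
  ring

theorem extrinsic_nablaVec_normal (hg : IsMetricOn g U) (ht : IsTimeFunctionOn g t U) (hx : x ∈ U)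
    (κ ν : Fin 4) : ∑ σ, extrinsic g t ν σ x * nablaVec g (normal g t) κ σ x =
      -(extrinsicSq g t κ ν x + normalForm g t κ x * extrinsicAccel g t ν x) := by
  simp only [nablaVec_normal hg ht hx, nabla₁_normalForm_eq hg ht hx, extrinsicSq, extrinsicAccel,
    Finset.mul_sum, ← Finset.sum_add_distrib, ← Finset.sum_neg_distrib]
  refine Finset.sum_congr rfl fun σ _ => Finset.sum_congr rfl fun ρ _ => ?_
  rw [extrinsic_symm hg ht hx κ ρ]
  ring

theorem normal_extrinsicSq (hg : IsMetricOn g U) (ht : IsTimeFunctionOn g t U) (hx : x ∈ U)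
    (ν : Fin 4) : ∑ κ, normal g t κ x * extrinsicSq g t κ ν x = 0 := by
  simp only [extrinsicSq, Finset.mul_sum]
  rw [← sum_pull_third]
  refine Finset.sum_eq_zero fun ρ _ => Finset.sum_eq_zero fun σ _ => ?_
  calc _ = (g x)⁻¹ ρ σ * extrinsic g t ν ρ x * ∑ κ, extrinsic g t σ κ x * normal g t κ x := by
        rw [Finset.mul_sum]
        exact Finset.sum_congr rfl fun _ _ => by ring
    _ = 0 := by rw [normal_extrinsic hg ht hx, mul_zero]

theorem normal_extrinsicAccel (hg : IsMetricOn g U) (ht : IsTimeFunctionOn g t U) (hx : x ∈ U) :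
    ∑ κ, normal g t κ x * extrinsicAccel g t κ x = 0 := by
  simp only [extrinsicAccel,
    Finset.mul_sum (s := Finset.univ) (f := fun σ => extrinsic g t _ σ x * _)]
  rw [Finset.sum_comm]
  refine Finset.sum_eq_zero fun σ _ => ?_
  calc _ = (∑ ρ, (g x)⁻¹ σ ρ * accel g t ρ x) * ∑ κ, extrinsic g t σ κ x * normal g t κ x := by
        rw [Finset.mul_sum]
        refine Finset.sum_congr rfl fun κ _ => ?_
        rw [extrinsic_symm hg ht hx σ κ]
        ring
    _ = 0 := by rw [normal_extrinsic hg ht hx, mul_zero]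

/-- The Lie derivative of the extrinsic curvature in terms of its covariant derivative. -/
theorem lieNormalK_eq (hg : IsMetricOn g U) (ht : IsTimeFunctionOn g t U) (hx : x ∈ U)
    (μ ν : Fin 4) : lieNormalK g t μ ν x =
      ∑ σ, normal g t σ x * nabla₂ g (extrinsic g t) σ μ ν x - 2 * extrinsicSq g t μ ν x
        - normalForm g t μ x * extrinsicAccel g t ν x
        - normalForm g t ν x * extrinsicAccel g t μ x := by
  have h : lieNormalK g t μ ν x = ∑ σ, normal g t σ x * nabla₂ g (extrinsic g t) σ μ ν x
      + ∑ σ, extrinsic g t ν σ x * nablaVec g (normal g t) μ σ x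
      + ∑ σ, extrinsic g t μ σ x * nablaVec g (normal g t) ν σ x := by
    have e : ∀ μ ν, ∑ σ, extrinsic g t σ ν x * ∑ κ, christoffel g σ μ κ x * normal g t κ x =
        ∑ σ, normal g t σ x * ∑ κ, christoffel g κ σ μ x * extrinsic g t κ ν x := by
      intro μ ν
      simp only [Finset.mul_sum]
      rw [Finset.sum_comm]
      refine Finset.sum_congr rfl fun σ _ => Finset.sum_congr rfl fun κ _ => ?_
      rw [hg.christoffel_symm hx]
      ring
    simp only [lieNormalK, nabla₂, nablaVec, mul_add, mul_sub, Finset.sum_add_distrib,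
      Finset.sum_sub_distrib]
    simp only [extrinsic_symm hg ht hx μ, extrinsic_symm hg ht hx ν, e]
    ring
  rw [h, extrinsic_nablaVec_normal hg ht hx, extrinsic_nablaVec_normal hg ht hx,
    extrinsicSq_symm hg ht hx ν μ]
  ring

/-- The Hessian of the lapse in terms of the acceleration, with the two slots interchanged. -/
theorem spatialHessLapse_eq (hg : IsMetricOn g U) (ht : IsTimeFunctionOn g t U) (hx : x ∈ U)
    (μ ν : Fin 4) : spatialHessLapse g t ν μ x =
      lapse g t x * (accel g t μ x * accel g t ν x +
        contract₂ (fun σ ρ => nabla₁ g (accel g t) σ ρ x) (projVec g t x μ) (projVec g t x ν)) := by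
  have dl := differentiableAt_of_smoothOn hg.isOpen (smooth_lapse hg ht) hx
  have dn := fun μ => differentiableAt_of_smoothOn hg.isOpen (smooth_normalForm hg ht μ) hx
  have da := fun μ => differentiableAt_of_smoothOn hg.isOpen (smooth_accel hg ht μ) hx
  have dpl := fun μ =>
    differentiableAt_of_smoothOn hg.isOpen (smoothOn_pd hg.isOpen (smooth_lapse hg ht) μ) hx
  have dc : DifferentiableAt ℝ (fun y => ∑ σ, normal g t σ y * pd σ (lapse g t) y) x :=
    DifferentiableAt.fun_sum fun σ _ =>
      (differentiableAt_of_smoothOn hg.isOpen (smooth_normal hg ht σ) hx).mul (dpl σ)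
  have h1 : ∀ ν μ, spatialHessLapse g t ν μ x =
      contract₂ (fun σ ρ => nabla₁ g (spatialGradLapse g t) σ ρ x) (projVec g t x ν)
        (projVec g t x μ) := fun _ _ => rfl
  -- `D_μ α` differs from the gradient of the lapse by a multiple of the normal, so that the
  -- symmetry of `D_ν D_μ α` follows from that of the Hessian and of the extrinsic curvature
  have hsymm : spatialHessLapse g t ν μ x = spatialHessLapse g t μ ν x := by
    have hB : ∀ a b, contract₂ (fun σ μ => nabla₁ g (normalForm g t) σ μ x) (projVec g t x a)
      (projVec g t x b) = -extrinsic g t a b x := fun a b => (neg_neg _).symm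
    have e : ∀ σ ρ, nabla₁ g (spatialGradLapse g t) σ ρ x =
        nabla₁ g (fun μ => pd μ (lapse g t)) σ ρ x
        + (pd σ (fun y => ∑ σ, normal g t σ y * pd σ (lapse g t) y) x * normalForm g t ρ x
        + (∑ σ, normal g t σ x * pd σ (lapse g t) x) * nabla₁ g (normalForm g t) σ ρ x) := by
      intro σ ρ
      rw [← nabla₁_mul dc dn, ← nabla₁_add
        (η := fun μ y => (∑ σ, normal g t σ y * pd σ (lapse g t) y) * normalForm g t μ y) dpl
        (fun μ => dc.mul (dn μ))]
      exact nabla₁_congr hg.isOpen hx (fun y hy μ => by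
        rw [spatialGradLapse_eq hg ht hy, lapse_mul_accel hg ht hy]) σ ρ
    have k : ∀ a b, spatialHessLapse g t a b x =
        contract₂ (fun σ ρ => nabla₁ g (fun μ => pd μ (lapse g t)) σ ρ x) (projVec g t x a)
          (projVec g t x b)
        - (∑ σ, normal g t σ x * pd σ (lapse g t) x) * extrinsic g t a b x := by
      intro a b
      simp only [h1, e, contract₂_add, contract₂_mul, contract₂_smul, projVec_normalForm ht hx, hB]
      ring
    rw [k, k, contract₂_comm, extrinsic_symm hg ht hx]
    simp only [hg.nabla₁_pd_comm hx (smooth_lapse hg ht)]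
  have e : ∀ σ ρ, nabla₁ g (spatialGradLapse g t) σ ρ x =
      pd σ (lapse g t) x * accel g t ρ x + lapse g t x * nabla₁ g (accel g t) σ ρ x := by
    intro σ ρ
    rw [← nabla₁_mul dl da]
    exact nabla₁_congr hg.isOpen hx (fun y hy μ => spatialGradLapse_eq hg ht hy μ) σ ρ
  have hgrad : ∑ σ, projVec g t x μ σ * pd σ (lapse g t) x = lapse g t x * accel g t μ x :=
    spatialGradLapse_eq hg ht hx μ
  rw [hsymm, h1]
  simp only [e, contract₂_add, contract₂_mul, contract₂_smul, hgrad, projVec_accel hg ht hx]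
  ring

/-- The Ricci identity for `n`, with one normal and two tangential slots. -/
theorem ricci_relation (hg : IsMetricOn g U) (ht : IsTimeFunctionOn g t U) (hx : x ∈ U)
    (μ ν : Fin 4) : ricciProj g t μ ν x =
      lieNormalK g t μ ν x + 1 / lapse g t x * spatialHessLapse g t ν μ x
        + ∑ ρ, ∑ σ, (g x)⁻¹ ρ σ * extrinsic g t σ μ x * extrinsic g t ν ρ x := by
  have h1 : ricciProj g t μ ν x = riemannApply g x (fun ρ => normal g t ρ x)
    (projVec g t x ν) (fun ρ => normal g t ρ x) (projVec g t x μ) := rfl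
  have hKK : ∑ ρ, ∑ σ, (g x)⁻¹ ρ σ * extrinsic g t σ μ x * extrinsic g t ν ρ x =
    extrinsicSq g t μ ν x := rfl
  have hBn : contract₂ (fun σ μ => nabla₁ g (normalForm g t) σ μ x) (fun ρ => normal g t ρ x)
      (projVec g t x μ) = accel g t μ x := by
    rw [contract₂_eq_left]
    exact projVec_accel hg ht hx μ
  have hnB : contract₂ (fun σ μ => nabla₁ g (normalForm g t) σ μ x) (projVec g t x μ)
      (fun ρ => normal g t ρ x) = 0 := by
    rw [contract₂_eq_right]
    simp [normal_nabla₁_normalForm hg ht hx]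
  have hnK : ∀ κ ν, ∑ σ, nabla₂ g (extrinsic g t) κ ν σ x * normal g t σ x =
      extrinsicSq g t κ ν x + normalForm g t κ x * extrinsicAccel g t ν x := fun κ ν => by
    rw [nabla₂_extrinsic_normal hg ht hx, extrinsic_nablaVec_normal hg ht hx, neg_neg]
  have hpn : contract₃ (fun σ μ ν => nabla₂ g (extrinsic g t) σ μ ν x) (projVec g t x μ)
      (fun ρ => normal g t ρ x) (projVec g t x ν) = extrinsicSq g t μ ν x := by
    rw [contract₃_eq_contract₂_second]
    have : ∀ σ ν, ∑ μ, nabla₂ g (extrinsic g t) σ μ ν x * normal g t μ x =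
        extrinsicSq g t σ ν x + normalForm g t σ x * extrinsicAccel g t ν x := fun σ ν => by
      rw [← hnK]
      exact Finset.sum_congr rfl fun _ _ => by rw [nabla₂_extrinsic_symm hg ht hx]
    have hr : ∀ μ, ∑ ρ, normal g t ρ x * extrinsicSq g t μ ρ x = 0 := fun μ => by
      simp only [extrinsicSq_symm hg ht hx μ, normal_extrinsicSq hg ht hx]
    simp only [this, contract₂_add, contract₂_mul, projVec_normalForm ht hx]
    simp [contract₂_projVec, normal_extrinsicSq hg ht hx, hr]
  have hnp : contract₃ (fun σ μ ν => nabla₂ g (extrinsic g t) σ μ ν x)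
      (fun ρ => normal g t ρ x) (projVec g t x μ) (projVec g t x ν) =
      ∑ σ, normal g t σ x * nabla₂ g (extrinsic g t) σ μ ν x
        - normalForm g t μ x * extrinsicAccel g t ν x
        - normalForm g t ν x * extrinsicAccel g t μ x := by
    have hL : ∀ ν, ∑ ρ, normal g t ρ x * ∑ σ, normal g t σ x * nabla₂ g (extrinsic g t) σ ν ρ x =
        -extrinsicAccel g t ν x := by
      intro ν
      calc _ = ∑ σ, normal g t σ x * ∑ ρ, nabla₂ g (extrinsic g t) σ ν ρ x * normal g t ρ x := by
            simp only [Finset.mul_sum]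
            rw [Finset.sum_comm]
            exact Finset.sum_congr rfl fun _ _ => Finset.sum_congr rfl fun _ _ => by ring
        _ = ∑ σ, normal g t σ x * extrinsicSq g t σ ν x
            + (∑ σ, normal g t σ x * normalForm g t σ x) * extrinsicAccel g t ν x := by
            rw [Finset.sum_mul, ← Finset.sum_add_distrib]
            exact Finset.sum_congr rfl fun _ _ => by rw [hnK]; ring
        _ = _ := by rw [normal_extrinsicSq hg ht hx, normal_unit ht hx]; ring
    have hL' : ∑ ρ, normal g t ρ x * ∑ σ, normal g t σ x * nabla₂ g (extrinsic g t) σ ρ ν x =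
        -extrinsicAccel g t ν x := by
      rw [← hL]
      exact Finset.sum_congr rfl fun _ _ => by simp only [nabla₂_extrinsic_symm hg ht hx _ _ ν]
    rw [contract₃_eq_contract₂_first, contract₂_projVec, hL']
    simp only [hL, mul_neg, Finset.sum_neg_distrib, normal_extrinsicAccel hg ht hx]
    ring
  rw [h1, hg.riemannApply_eq_contract₃ hx (smooth_normalForm hg ht) (lower_normal hg hx)]
  simp only [contract₃_nabla₂_nabla₁_normalForm hg ht hx, projVec_normalForm ht hx, hBn, hnB,
    normal_unit ht hx, projVec_accel hg ht hx, hpn, hnp]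
  rw [lieNormalK_eq hg ht hx, spatialHessLapse_eq hg ht hx, hKK]
  have hl := (lapse_pos ht hx).ne'
  field_simp
  ring

end Slicing

/-! ### Lorentzian linear algebra -/

section Lorentz

variable {g : MetricField 4} {U : Set (Coord 4)} {x : Coord 4}

theorem scalarProd_eq_dotProduct {d : ℕ} (g : MetricField d) (x v w : Coord d) :
    scalarProd g x v w = v ⬝ᵥ (g x).mulVec w := by
  simp only [scalarProd, dotProduct, Matrix.mulVec, Finset.mul_sum]
  exact Finset.sum_congr rfl fun _ _ => Finset.sum_congr rfl fun _ _ => by ring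

theorem IsLorentzMetricOn.isMetricOn (hU : IsOpen U) (hg : IsLorentzMetricOn g U) :
    IsMetricOn g U where
  isOpen := hU
  smooth := hg.smooth
  symm x hx μ ν := by
    obtain ⟨P, hP, h⟩ := hg.signature x hx
    have h1 : P.transpose * (g x).transpose * P = P.transpose * g x * P := by
      have := congrArg Matrix.transpose h
      rw [Matrix.diagonal_transpose, ← h] at this
      simpa [Matrix.transpose_mul, Matrix.mul_assoc] using this
    have hP' : IsUnit P.transpose.det := by rwa [Matrix.det_transpose]
    have h2 : (g x).transpose = g x := by
      have h3 := congrArg (fun M => P.transpose⁻¹ * M * P⁻¹) h1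
      simpa [Matrix.mul_assoc, Matrix.mul_nonsing_inv _ hP,
        Matrix.nonsing_inv_mul_cancel_left _ _ hP'] using h3
    exact congrFun (congrFun h2 ν) μ
  det_ne_zero x hx h0 := by
    obtain ⟨P, hP, h⟩ := hg.signature x hx
    have := congrArg Matrix.det h
    rw [Matrix.det_mul, Matrix.det_mul, h0, Matrix.det_diagonal] at this
    simp [Fin.prod_univ_four] at this

/-- The orthogonal complement of a timelike vector is positive definite. -/
theorem IsLorentzMetricOn.scalarProd_self_pos (hg : IsLorentzMetricOn g U) (hx : x ∈ U)
    {v w : Coord 4} (hv : scalarProd g x v v < 0) (hvw : scalarProd g x v w = 0) (hw : w ≠ 0) :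
    0 < scalarProd g x w w := by
  obtain ⟨P, hP, h⟩ := hg.signature x hx
  have key : ∀ a b : Coord 4, scalarProd g x (P.mulVec a) (P.mulVec b) =
      -(a 0 * b 0) + a 1 * b 1 + a 2 * b 2 + a 3 * b 3 := by
    intro a b
    rw [scalarProd_eq_dotProduct, Matrix.mulVec_mulVec, ← Matrix.vecMul_transpose,
      ← Matrix.dotProduct_mulVec, Matrix.mulVec_mulVec, ← Matrix.mul_assoc, h,
      dotProduct, Fin.sum_univ_four]
    simp only [Matrix.mulVec_diagonal]
    simp
  obtain ⟨a, rfl⟩ : ∃ a, v = P.mulVec a :=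
    ⟨P⁻¹.mulVec v, by rw [Matrix.mulVec_mulVec, Matrix.mul_nonsing_inv _ hP, Matrix.one_mulVec]⟩
  obtain ⟨b, rfl⟩ : ∃ b, w = P.mulVec b :=
    ⟨P⁻¹.mulVec w, by rw [Matrix.mulVec_mulVec, Matrix.mul_nonsing_inv _ hP, Matrix.one_mulVec]⟩
  rw [key] at hv hvw ⊢
  by_contra hcon
  -- Cauchy-Schwarz for the spatial components
  have hcs : (a 1 * b 1 + a 2 * b 2 + a 3 * b 3) ^ 2 ≤
      (a 1 ^ 2 + a 2 ^ 2 + a 3 ^ 2) * (b 1 ^ 2 + b 2 ^ 2 + b 3 ^ 2) := by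
    linarith [sq_nonneg (a 1 * b 2 - a 2 * b 1), sq_nonneg (a 1 * b 3 - a 3 * b 1),
      sq_nonneg (a 2 * b 3 - a 3 * b 2)]
  have he : a 1 * b 1 + a 2 * b 2 + a 3 * b 3 = a 0 * b 0 := by linarith
  rw [he] at hcs
  set A := a 1 ^ 2 + a 2 ^ 2 + a 3 ^ 2 with hA
  set B := b 1 ^ 2 + b 2 ^ 2 + b 3 ^ 2 with hB
  have hA0 : 0 ≤ A := by positivity
  have hB0 : 0 ≤ B := by positivity
  have h1 : A < a 0 ^ 2 := by rw [hA]; nlinarith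
  have h2 : B ≤ b 0 ^ 2 := by rw [hB]; nlinarith
  have h3 : a 0 ^ 2 * b 0 ^ 2 ≤ A * b 0 ^ 2 := by
    calc _ = (a 0 * b 0) ^ 2 := by ring
      _ ≤ A * B := hcs
      _ ≤ A * b 0 ^ 2 := mul_le_mul_of_nonneg_left h2 hA0
  have h4 : b 0 ^ 2 = 0 := by
    by_contra h0
    have : 0 < b 0 ^ 2 := lt_of_le_of_ne (sq_nonneg _) (Ne.symm h0)
    nlinarith
  have h5 : B = 0 := le_antisymm (h2.trans h4.le) hB0
  apply hw
  have hb0 : b 0 = 0 := by simpa using h4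
  have hb1 : b 1 = 0 :=
    pow_eq_zero_iff two_ne_zero |>.1
      (by linarith [sq_nonneg (b 1), sq_nonneg (b 2), sq_nonneg (b 3)])
  have hb2 : b 2 = 0 :=
    pow_eq_zero_iff two_ne_zero |>.1
      (by linarith [sq_nonneg (b 1), sq_nonneg (b 2), sq_nonneg (b 3)])
  have hb3 : b 3 = 0 :=
    pow_eq_zero_iff two_ne_zero |>.1
      (by linarith [sq_nonneg (b 1), sq_nonneg (b 2), sq_nonneg (b 3)])
  have : b = 0 := by
    funext i
    fin_cases i <;> assumption
  rw [this, Matrix.mulVec_zero]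

variable {t : Coord 4 → ℝ}

theorem scalarProd_normal_right (hg : IsMetricOn g U) (hx : x ∈ U) (w : Coord 4) :
    scalarProd g x w (fun μ => normal g t μ x) = ∑ μ, normalForm g t μ x * w μ := by
  simp only [scalarProd, ← lower_normal hg hx, Finset.sum_mul]
  exact Finset.sum_congr rfl fun _ _ => Finset.sum_congr rfl fun _ _ => by ring

theorem scalarProd_normal_left (hg : IsMetricOn g U) (hx : x ∈ U) (w : Coord 4) :
    scalarProd g x (fun μ => normal g t μ x) w = ∑ μ, normalForm g t μ x * w μ := by
  rw [hg.scalarProd_comm hx, scalarProd_normal_right hg hx]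

/-- Nonzero vectors tangent to the slices are spacelike. -/
theorem IsLorentzMetricOn.scalarProd_self_pos_of_tangent (hU : IsOpen U)
    (hg : IsLorentzMetricOn g U) (ht : IsTimeFunctionOn g t U) (hx : x ∈ U) {w : Coord 4}
    (hnw : ∑ μ, normalForm g t μ x * w μ = 0) (hw : w ≠ 0) : 0 < scalarProd g x w w := by
  have hm := hg.isMetricOn hU
  refine hg.scalarProd_self_pos hx (v := fun μ => normal g t μ x) ?_ ?_ hw
  · rw [scalarProd_normal_right hm hx]
    have := normal_unit ht hx
    simp only [mul_comm (normal g t _ x)] at this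
    rw [this]
    norm_num
  · rw [scalarProd_normal_left hm hx, hnw]

end Lorentz

/-! ### The geometry of a slice -/

section Slice

variable {g : MetricField 4} {t : Coord 4 → ℝ} {U : Set (Coord 4)} {W : Set (Coord 3)}
  {ψ : Coord 3 → Coord 4} {y : Coord 3}

theorem IsSliceParam.isSmoothMapInto (hψ : IsSliceParam t U W ψ) : IsSmoothMapInto ψ W U :=
  ⟨hψ.isOpen, fun μ => contDiffOn_pi.1 hψ.smooth μ, hψ.mapsTo⟩

/-- The coordinate vectors of a slice are orthogonal to the normal. -/
theorem IsSliceParam.normalForm_tangentField (hψ : IsSliceParam t U W ψ) (hU : IsOpen U)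
    (ht : IsTimeFunctionOn g t U) (hy : y ∈ W) (i : Fin 3) :
    ∑ μ, normalForm g t μ (ψ y) * tangentField ψ i μ y = 0 := by
  obtain ⟨t₀, h⟩ := hψ.level
  have h1 := hψ.isSmoothMapInto.pd_comp hU ht.smooth hy i
  rw [pd_congr_of_eqOn hψ.isOpen hy h, pd_const] at h1
  have : ∑ μ, normalForm g t μ (ψ y) * tangentField ψ i μ y =
      -lapse g t (ψ y) * ∑ μ, tangentField ψ i μ y * pd μ t (ψ y) := by
    rw [Finset.mul_sum]
    exact Finset.sum_congr rfl fun _ _ => by rw [normalForm]; ring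
  rw [this, ← h1, mul_zero]

theorem sliceMetric_apply (z : Coord 3) (a b : Fin 3) : sliceMetric g ψ z a b =
    scalarProd g (ψ z) (fun μ => tangentField ψ a μ z) (fun μ => tangentField ψ b μ z) := rfl

theorem scalarProd_sum_smul_left {d : ℕ} {ι : Type*} [Fintype ι] (g : MetricField d) (x : Coord d)
    (v : ι → ℝ) (e : ι → Coord d) (w : Coord d) :
    scalarProd g x (fun μ => ∑ i, v i * e i μ) w = ∑ i, v i * scalarProd g x (e i) w := by
  rw [scalarProd_sum_left (v := fun i μ => v i * e i μ)]
  exact Finset.sum_congr rfl fun _ _ => scalarProd_smul_left _ _ _ _ _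

/-- The induced metric of a slice is a metric. -/
theorem IsSliceParam.isMetricOn (hψ : IsSliceParam t U W ψ) (hU : IsOpen U)
    (hg : IsLorentzMetricOn g U) (ht : IsTimeFunctionOn g t U) :
    IsMetricOn (sliceMetric g ψ) W where
  isOpen := hψ.isOpen
  smooth i j := smooth_scalarProd_along (hg.isMetricOn hU) hψ.isSmoothMapInto
    (hψ.isSmoothMapInto.smooth_tangentField i) (hψ.isSmoothMapInto.smooth_tangentField j)
  symm y hy i j := by
    rw [sliceMetric_apply, sliceMetric_apply, (hg.isMetricOn hU).scalarProd_comm (hψ.mapsTo y hy)]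
  det_ne_zero y hy h0 := by
    obtain ⟨v, hv, h⟩ := Matrix.exists_mulVec_eq_zero_iff.2 h0
    have hm := hg.isMetricOn hU
    have hx := hψ.mapsTo y hy
    set w : Coord 4 := fun μ => ∑ i, v i * tangentField ψ i μ y with hwdef
    have hw0 : w ≠ 0 := by
      intro hw
      apply hv
      apply hψ.immersion y hy
      rw [map_zero, ← hw]
      funext μ
      have hd := fun μ => differentiableAt_of_smoothOn hψ.isOpen (hψ.isSmoothMapInto.smooth μ) hy
      rw [fderiv_pi hd]
      exact fderiv_apply_eq_sum_pd v
    have hnw : ∑ μ, normalForm g t μ (ψ y) * w μ = 0 := by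
      simp only [hwdef, Finset.mul_sum]
      rw [Finset.sum_comm]
      refine Finset.sum_eq_zero fun i _ => ?_
      calc _ = v i * ∑ μ, normalForm g t μ (ψ y) * tangentField ψ i μ y := by
            rw [Finset.mul_sum]
            exact Finset.sum_congr rfl fun _ _ => by ring
        _ = 0 := by rw [hψ.normalForm_tangentField hU ht hy, mul_zero]
    have hpos := hg.scalarProd_self_pos_of_tangent hU ht hx hnw hw0
    have hzero : scalarProd g (ψ y) w w = 0 := by
      rw [hwdef, scalarProd_sum_smul_left g (ψ y) v (fun i μ => tangentField ψ i μ y)]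
      refine Finset.sum_eq_zero fun i _ => ?_
      rw [hm.scalarProd_comm hx,
        scalarProd_sum_smul_left g (ψ y) v (fun i μ => tangentField ψ i μ y)]
      have h1 := congrFun h i
      simp only [Matrix.mulVec, dotProduct, sliceMetric_apply, Pi.zero_apply] at h1
      have h2 : ∑ j, v j * scalarProd g (ψ y) (fun μ => tangentField ψ j μ y)
          (fun μ => tangentField ψ i μ y) = 0 := by
        rw [← h1]
        exact Finset.sum_congr rfl fun j _ => by rw [hm.scalarProd_comm hx, mul_comm]
      rw [h2, mul_zero]
    exact hpos.ne' hzero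

theorem sliceCoframe_apply (i : Fin 3) (v : Coord 4) :
    ∑ μ, sliceCoframe g ψ i μ y * v μ = ∑ j, (sliceMetric g ψ y)⁻¹ i j *
      scalarProd g (ψ y) v (fun μ => tangentField ψ j μ y) := by
  simp only [sliceCoframe, scalarProd, Finset.sum_mul, Finset.mul_sum]
  rw [Finset.sum_comm]
  exact Finset.sum_congr rfl fun _ _ => Finset.sum_congr rfl fun _ _ =>
    Finset.sum_congr rfl fun _ _ => by simp only [tangentField]; ring

/-- The coordinate vectors of the slice and their coframe resolve the projector:
`γ^ρ_μ = ∂_i ψ^ρ θ^i_μ`. Together with the normal they form a basis and its dual basis. -/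
theorem IsSliceParam.proj_eq (hψ : IsSliceParam t U W ψ) (hU : IsOpen U)
    (hg : IsLorentzMetricOn g U) (ht : IsTimeFunctionOn g t U) (hy : y ∈ W) (ρ μ : Fin 4) :
    proj g t ρ μ (ψ y) = ∑ i, sliceCoframe g ψ i μ y * tangentField ψ i ρ y := by
  have hm := hg.isMetricOn hU
  have hx := hψ.mapsTo y hy
  have hγ := hψ.isMetricOn hU hg ht
  let A : Matrix (Fin 4) (Unit ⊕ Fin 3) ℝ := Matrix.of fun ρ =>
    Sum.elim (fun _ => normal g t ρ (ψ y)) (fun i => tangentField ψ i ρ y)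
  let B : Matrix (Unit ⊕ Fin 3) (Fin 4) ℝ := Matrix.of
    (Sum.elim (fun _ μ => -normalForm g t μ (ψ y)) (fun i μ => sliceCoframe g ψ i μ y))
  have hBA : B * A = 1 := by
    ext a b
    rw [Matrix.mul_apply]
    rcases a with _ | i <;> rcases b with _ | j
    · have := normal_unit ht hx
      simp only [mul_comm (normal g t _ (ψ y))] at this
      simp [A, B, this]
    · simp [A, B, hψ.normalForm_tangentField hU ht hy]
    · have := sliceCoframe_apply (g := g) (ψ := ψ) (y := y) i (fun μ => normal g t μ (ψ y))
      simp only [scalarProd_normal_left hm hx, hψ.normalForm_tangentField hU ht hy] at this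
      simpa [A, B] using this
    · have := sliceCoframe_apply (g := g) (ψ := ψ) (y := y) i (fun μ => tangentField ψ j μ y)
      simp only [hm.scalarProd_comm hx (fun μ => tangentField ψ j μ y), ← sliceMetric_apply,
        hγ.sum_inv_mul hy] at this
      simpa [A, B, Matrix.one_apply] using this
  have hAB : A * B = 1 := (Matrix.mul_eq_one_comm_of_card_eq _ _ _ (by simp)).1 hBA
  have := congrFun (congrFun hAB ρ) μ
  rw [Matrix.mul_apply, Matrix.one_apply] at this
  simp only [A, B, Fintype.sum_sum_type, Matrix.of_apply, Sum.elim_inl, Sum.elim_inr,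
    Finset.univ_unique, Finset.sum_singleton] at this
  rw [proj, ← this]
  simp only [mul_comm (sliceCoframe g ψ _ μ y)]
  ring

/-- The splitting of the scalar product into its normal and tangential parts. -/
theorem IsSliceParam.scalarProd_split (hψ : IsSliceParam t U W ψ) (hU : IsOpen U)
    (hg : IsLorentzMetricOn g U) (ht : IsTimeFunctionOn g t U) (hy : y ∈ W) (X Y : Coord 4) :
    scalarProd g (ψ y) X Y =
      ∑ i, ∑ j, (sliceMetric g ψ y)⁻¹ i j *
        scalarProd g (ψ y) X (fun μ => tangentField ψ i μ y) *
        scalarProd g (ψ y) Y (fun μ => tangentField ψ j μ y)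
      - (∑ μ, normalForm g t μ (ψ y) * X μ) * ∑ μ, normalForm g t μ (ψ y) * Y μ := by
  have hm := hg.isMetricOn hU
  have hx := hψ.mapsTo y hy
  have hY : Y = fun ρ => (∑ i, (∑ μ, sliceCoframe g ψ i μ y * Y μ) * tangentField ψ i ρ y) +
      -(∑ μ, normalForm g t μ (ψ y) * Y μ) * normal g t ρ (ψ y) := by
    funext ρ
    have h1 : ∑ μ, proj g t ρ μ (ψ y) * Y μ =
        Y ρ + normal g t ρ (ψ y) * ∑ μ, normalForm g t μ (ψ y) * Y μ := by
      simp only [proj, add_mul, Finset.sum_add_distrib, ite_mul, one_mul, zero_mul,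
        Finset.sum_ite_eq, Finset.mem_univ, if_true, Finset.mul_sum, mul_assoc]
    have h2 : ∑ μ, proj g t ρ μ (ψ y) * Y μ =
        ∑ i, (∑ μ, sliceCoframe g ψ i μ y * Y μ) * tangentField ψ i ρ y := by
      simp only [hψ.proj_eq hU hg ht hy, Finset.sum_mul]
      rw [Finset.sum_comm]
      exact Finset.sum_congr rfl fun _ _ => Finset.sum_congr rfl fun _ _ => by ring
    rw [← h2, h1]
    ring
  have h3 : scalarProd g (ψ y) X Y =
      (∑ i, (∑ μ, sliceCoframe g ψ i μ y * Y μ) *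
        scalarProd g (ψ y) X (fun μ => tangentField ψ i μ y))
      - (∑ μ, normalForm g t μ (ψ y) * X μ) * ∑ μ, normalForm g t μ (ψ y) * Y μ := by
    conv_lhs => rw [hm.scalarProd_comm hx, hY]
    rw [scalarProd_add_left, scalarProd_smul_left, scalarProd_normal_left hm hx,
      scalarProd_sum_smul_left g (ψ y) _ (fun i μ => tangentField ψ i μ y)]
    simp only [hm.scalarProd_comm hx X]
    ring
  rw [h3]
  congr 1
  refine Finset.sum_congr rfl fun i _ => ?_
  rw [sliceCoframe_apply, Finset.sum_mul]
  exact Finset.sum_congr rfl fun _ _ => by ring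

end Slice

/-! ### The Gauss relation -/

section Gauss

theorem riemannApply_sum₁ {d : ℕ} {ι : Type*} [Fintype ι] (g : MetricField d) (x : Coord d)
    (e : ι → Coord d) (p : ι → ℝ) (b c f : Coord d) :
    riemannApply g x (fun μ => ∑ i, p i * e i μ) b c f =
      ∑ i, p i * riemannApply g x (e i) b c f := by
  simp only [riemannApply, Finset.mul_sum, Finset.sum_mul]
  rw [sum_pull_fifth]
  exact Finset.sum_congr rfl fun _ _ => Finset.sum_congr rfl fun _ _ =>
    Finset.sum_congr rfl fun _ _ => Finset.sum_congr rfl fun _ _ =>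
    Finset.sum_congr rfl fun _ _ => by ring

theorem riemannApply_sum₂ {d : ℕ} {ι : Type*} [Fintype ι] (g : MetricField d) (x : Coord d)
    (e : ι → Coord d) (p : ι → ℝ) (b c f : Coord d) :
    riemannApply g x b (fun μ => ∑ i, p i * e i μ) c f =
      ∑ i, p i * riemannApply g x b (e i) c f := by
  simp only [riemannApply, Finset.mul_sum, Finset.sum_mul]
  rw [sum_pull_fifth]
  exact Finset.sum_congr rfl fun _ _ => Finset.sum_congr rfl fun _ _ =>
    Finset.sum_congr rfl fun _ _ => Finset.sum_congr rfl fun _ _ =>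
    Finset.sum_congr rfl fun _ _ => by ring

theorem riemannApply_sum₃ {d : ℕ} {ι : Type*} [Fintype ι] (g : MetricField d) (x : Coord d)
    (e : ι → Coord d) (p : ι → ℝ) (b c f : Coord d) :
    riemannApply g x b c (fun μ => ∑ i, p i * e i μ) f =
      ∑ i, p i * riemannApply g x b c (e i) f := by
  simp only [riemannApply, Finset.mul_sum, Finset.sum_mul]
  rw [sum_pull_fifth]
  exact Finset.sum_congr rfl fun _ _ => Finset.sum_congr rfl fun _ _ =>
    Finset.sum_congr rfl fun _ _ => Finset.sum_congr rfl fun _ _ =>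
    Finset.sum_congr rfl fun _ _ => by ring

theorem riemannApply_sum₄ {d : ℕ} {ι : Type*} [Fintype ι] (g : MetricField d) (x : Coord d)
    (e : ι → Coord d) (p : ι → ℝ) (b c f : Coord d) :
    riemannApply g x b c f (fun μ => ∑ i, p i * e i μ) =
      ∑ i, p i * riemannApply g x b c f (e i) := by
  simp only [riemannApply, Finset.mul_sum]
  rw [sum_pull_fifth]
  exact Finset.sum_congr rfl fun _ _ => Finset.sum_congr rfl fun _ _ =>
    Finset.sum_congr rfl fun _ _ => Finset.sum_congr rfl fun _ _ =>
    Finset.sum_congr rfl fun _ _ => by ring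

theorem riemannApply_sum_smul {d : ℕ} {ι : Type*} [Fintype ι] (g : MetricField d) (x : Coord d)
    (e : ι → Coord d) (p q r s : ι → ℝ) :
    riemannApply g x (fun μ => ∑ i, p i * e i μ) (fun μ => ∑ i, q i * e i μ)
        (fun μ => ∑ i, r i * e i μ) (fun μ => ∑ i, s i * e i μ) =
      ∑ i, ∑ j, ∑ k, ∑ l, riemannApply g x (e i) (e j) (e k) (e l) * p i * q j * r k * s l := by
  rw [riemannApply_sum₁]
  refine Finset.sum_congr rfl fun _ _ => ?_
  rw [riemannApply_sum₂, Finset.mul_sum]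
  refine Finset.sum_congr rfl fun _ _ => ?_
  rw [riemannApply_sum₃, Finset.mul_sum, Finset.mul_sum]
  refine Finset.sum_congr rfl fun _ _ => ?_
  rw [riemannApply_sum₄, Finset.mul_sum, Finset.mul_sum, Finset.mul_sum]
  exact Finset.sum_congr rfl fun _ _ => by ring

variable {g : MetricField 4} {t : Coord 4 → ℝ} {U : Set (Coord 4)} {W : Set (Coord 3)}
  {ψ : Coord 3 → Coord 4} {y : Coord 3}

theorem IsMetricOn.scalarProd_eq_inv {d : ℕ} {g : MetricField d} {O : Set (Coord d)} {x : Coord d}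
    (hg : IsMetricOn g O) (hx : x ∈ O) (v w : Coord d) :
    scalarProd g x v w = ∑ i, ∑ j, (g x)⁻¹ i j * (∑ a, g x i a * v a) * ∑ b, g x j b * w b := by
  have h : ∀ i, ∑ j, (g x)⁻¹ i j * (∑ a, g x i a * v a) * ∑ b, g x j b * w b =
      (∑ a, g x i a * v a) * w i := by
    intro i
    rw [← hg.raise_lower hx w i, Finset.mul_sum]
    exact Finset.sum_congr rfl fun _ _ => by ring
  simp only [h, scalarProd, Finset.sum_mul]
  rw [Finset.sum_comm]
  refine Finset.sum_congr rfl fun _ _ => Finset.sum_congr rfl fun _ _ => ?_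
  rw [hg.symm x hx]

/-- Gauss' formula: the normal component of `∇_i ∂_j ψ` is the extrinsic curvature, as one sees by
differentiating `g(n, ∂_j ψ) = 0`. -/
theorem IsSliceParam.normalForm_covAlong (hψ : IsSliceParam t U W ψ) (hU : IsOpen U)
    (hg : IsLorentzMetricOn g U) (ht : IsTimeFunctionOn g t U) (hy : y ∈ W) (i j : Fin 3) :
    ∑ μ, normalForm g t μ (ψ y) * covAlong g ψ (tangentField ψ j) i μ y =
      contract₂ (fun μ ν => extrinsic g t μ ν (ψ y)) (fun μ => tangentField ψ i μ y)
        (fun μ => tangentField ψ j μ y) := by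
  have hm := hg.isMetricOn hU
  have hx := hψ.mapsTo y hy
  have hs := hψ.isSmoothMapInto
  have hn : ∀ μ, ContDiffOn ℝ ∞ (fun z => normal g t μ (ψ z)) W := fun μ =>
    hs.comp (smooth_normal hm ht μ)
  have h0 : pd i (fun z => scalarProd g (ψ z) (fun μ => normal g t μ (ψ z))
      (fun μ => tangentField ψ j μ z)) y = 0 := by
    rw [pd_congr_of_eqOn hψ.isOpen hy (h := fun _ => 0), pd_const]
    intro z hz
    rw [scalarProd_normal_left hm (hψ.mapsTo z hz), hψ.normalForm_tangentField hU ht hz]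
  rw [pd_scalarProd_along (Z := fun μ z => normal g t μ (ψ z)) hm hs hy hn
    (hs.smooth_tangentField j) i, scalarProd_normal_left hm hx] at h0
  have h1 : ∀ μ, covAlong g ψ (fun μ z => normal g t μ (ψ z)) i μ y =
      ∑ σ, tangentField ψ i σ y * nablaVec g (normal g t) σ μ (ψ y) := by
    intro μ
    rw [covAlong, hs.pd_comp hU (smooth_normal hm ht μ) hy]
    simp only [nablaVec, mul_add, Finset.sum_add_distrib, Finset.mul_sum]
    congr 1
    exact Finset.sum_congr rfl fun _ _ => Finset.sum_congr rfl fun _ _ => by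
      simp only [tangentField]; ring
  have h2 : scalarProd g (ψ y) (fun μ => covAlong g ψ (fun μ z => normal g t μ (ψ z)) i μ y)
      (fun μ => tangentField ψ j μ y) =
      contract₂ (fun σ ν => nabla₁ g (normalForm g t) σ ν (ψ y)) (fun μ => tangentField ψ i μ y)
        (fun μ => tangentField ψ j μ y) := by
    simp only [h1]
    rw [scalarProd_sum_smul_left g (ψ y) _ (fun σ μ => nablaVec g (normal g t) σ μ (ψ y)),
      contract₂_eq_right]
    refine Finset.sum_congr rfl fun σ _ => ?_
    congr 1
    simp only [nabla₁_normalForm hm ht hx, scalarProd, Finset.mul_sum]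
    rw [Finset.sum_comm]
    refine Finset.sum_congr rfl fun _ _ => Finset.sum_congr rfl fun _ _ => ?_
    rw [hm.symm _ hx]
    ring
  have h3 : ∑ μ, tangentField ψ i μ y * normalForm g t μ (ψ y) = 0 := by
    simpa only [mul_comm] using hψ.normalForm_tangentField hU ht hy i
  rw [h2] at h0
  simp only [nabla₁_normalForm_eq hm ht hx, contract₂_neg, contract₂_add, contract₂_mul, h3] at h0
  linarith

/-- The Gauss relation in the coordinate frame of the slice. -/
theorem IsSliceParam.gauss_tangent (hψ : IsSliceParam t U W ψ) (hU : IsOpen U)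
    (hg : IsLorentzMetricOn g U) (ht : IsTimeFunctionOn g t U) (hy : y ∈ W) (i j k l : Fin 3) :
    riemannApply g (ψ y) (fun μ => tangentField ψ i μ y) (fun μ => tangentField ψ j μ y)
        (fun μ => tangentField ψ k μ y) (fun μ => tangentField ψ l μ y) =
      riemann (sliceMetric g ψ) i j k l y
      + contract₂ (fun μ ν => extrinsic g t μ ν (ψ y)) (fun μ => tangentField ψ i μ y)
          (fun μ => tangentField ψ k μ y) *
        contract₂ (fun μ ν => extrinsic g t μ ν (ψ y)) (fun μ => tangentField ψ j μ y)
          (fun μ => tangentField ψ l μ y)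
      - contract₂ (fun μ ν => extrinsic g t μ ν (ψ y)) (fun μ => tangentField ψ i μ y)
          (fun μ => tangentField ψ l μ y) *
        contract₂ (fun μ ν => extrinsic g t μ ν (ψ y)) (fun μ => tangentField ψ j μ y)
          (fun μ => tangentField ψ k μ y) := by
  have hm := hg.isMetricOn hU
  have hx := hψ.mapsTo y hy
  have hs := hψ.isSmoothMapInto
  have hγ := hψ.isMetricOn hU hg ht
  -- the ambient connection along `ψ`, paired with tangent vectors, and the intrinsic connection
  -- have the same Christoffel symbols of the first kind: both are given by Koszul's formula
  have hL : ∀ z ∈ W, ∀ a b c, lowerChristoffel g ψ a b c z =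
      lowerChristoffel (sliceMetric g ψ) (fun y => y) a b c z := by
    intro z hz a b c
    rw [lowerChristoffel_eq hm hs hz (sliceMetric g ψ) (fun _ _ _ _ => rfl),
      lowerChristoffel_eq hγ hγ.isSmoothMapInto_id hz (sliceMetric g ψ)
        (fun a b z _ => (scalarProd_tangentField_id a b).symm)]
  have hLΓ : ∀ p a b, lowerChristoffel (sliceMetric g ψ) (fun y => y) p a b y =
      ∑ m, sliceMetric g ψ y p m * christoffel (sliceMetric g ψ) m a b y := by
    intro p a b
    rw [lowerChristoffel, hγ.scalarProd_comm hy]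
    simp [scalarProd, tangentField_id, covAlong_tangentField_id]
  have hquad : ∀ a b c e, scalarProd g (ψ y) (fun μ => covAlong g ψ (tangentField ψ b) a μ y)
      (fun μ => covAlong g ψ (tangentField ψ e) c μ y) =
      scalarProd (sliceMetric g ψ) y (fun m => christoffel (sliceMetric g ψ) m a b y)
        (fun m => christoffel (sliceMetric g ψ) m c e y)
      - contract₂ (fun μ ν => extrinsic g t μ ν (ψ y)) (fun μ => tangentField ψ a μ y)
          (fun μ => tangentField ψ b μ y) *
        contract₂ (fun μ ν => extrinsic g t μ ν (ψ y)) (fun μ => tangentField ψ c μ y)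
          (fun μ => tangentField ψ e μ y) := by
    intro a b c e
    rw [hψ.scalarProd_split hU hg ht hy, hψ.normalForm_covAlong hU hg ht hy,
      hψ.normalForm_covAlong hU hg ht hy, hγ.scalarProd_eq_inv hy]
    congr 1
    refine Finset.sum_congr rfl fun p _ => Finset.sum_congr rfl fun q _ => ?_
    rw [← hLΓ, ← hLΓ, ← hL y hy, ← hL y hy]
    rfl
  have hsymm : ∀ a b, contract₂ (fun μ ν => extrinsic g t μ ν (ψ y))
      (fun μ => tangentField ψ a μ y) (fun μ => tangentField ψ b μ y) =
      contract₂ (fun μ ν => extrinsic g t μ ν (ψ y)) (fun μ => tangentField ψ b μ y)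
        (fun μ => tangentField ψ a μ y) := by
    intro a b
    rw [contract₂_comm]
    simp only [extrinsic_symm hm ht hx]
  rw [riemannApply_tangentField hm hs hy, hγ.riemann_eq hy, hquad, hquad,
    pd_congr_of_eqOn hψ.isOpen hy (fun z hz => hL z hz i l j),
    pd_congr_of_eqOn hψ.isOpen hy (fun z hz => hL z hz i k j), hsymm j k, hsymm j l, hsymm i k,
    hsymm i l]
  ring

theorem contract₂_sum_smul {d : ℕ} {ι : Type*} [Fintype ι] (T : Fin d → Fin d → ℝ)
    (e : ι → Coord d) (p q : ι → ℝ) :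
    contract₂ T (fun μ => ∑ i, p i * e i μ) (fun μ => ∑ i, q i * e i μ) =
      ∑ i, ∑ j, contract₂ T (e i) (e j) * p i * q j := by
  have h : ∀ (q : ι → ℝ) (X : Fin d → ℝ), ∑ ν, (∑ j, q j * e j ν) * X ν =
      ∑ j, q j * ∑ ν, e j ν * X ν := by
    intro q X
    simp only [Finset.sum_mul, Finset.mul_sum]
    rw [Finset.sum_comm]
    exact Finset.sum_congr rfl fun _ _ => Finset.sum_congr rfl fun _ _ => by ring
  rw [contract₂_eq_right, h]
  refine Finset.sum_congr rfl fun i _ => ?_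
  rw [← contract₂_eq_right, contract₂_eq_left, h, Finset.mul_sum]
  refine Finset.sum_congr rfl fun j _ => ?_
  rw [← contract₂_eq_left]
  ring

theorem contract₂_extrinsic_projVec {x : Coord 4} (hg : IsMetricOn g U)
    (ht : IsTimeFunctionOn g t U) (hx : x ∈ U) (μ ν : Fin 4) :
    contract₂ (fun μ ν => extrinsic g t μ ν x) (projVec g t x μ) (projVec g t x ν) =
      extrinsic g t μ ν x := by
  rw [contract₂_eq_right]
  simp only [projVec_extrinsic hg ht hx]
  simp only [extrinsic_symm hg ht hx _ ν, projVec_extrinsic hg ht hx]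

/-- The Gauss relation: both sides are spatial tensors, so that it suffices to compare them on the
coordinate frame of the slice. -/
theorem IsSliceParam.gauss_relation (hψ : IsSliceParam t U W ψ) (hU : IsOpen U)
    (hg : IsLorentzMetricOn g U) (ht : IsTimeFunctionOn g t U) (hy : y ∈ W) (μ α β ν : Fin 4) :
    gaussProj g t μ α β ν (ψ y) = sliceRiemann g ψ μ α β ν y
      + extrinsic g t μ β (ψ y) * extrinsic g t α ν (ψ y)
      - extrinsic g t μ ν (ψ y) * extrinsic g t β α (ψ y) := by
  have hm := hg.isMetricOn hU
  have hx := hψ.mapsTo y hy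
  have hp : ∀ μ, projVec g t (ψ y) μ =
      fun ρ => ∑ i, sliceCoframe g ψ i μ y * tangentField ψ i ρ y := fun μ =>
    funext fun ρ => hψ.proj_eq hU hg ht hy ρ μ
  have hK : ∀ μ ν, extrinsic g t μ ν (ψ y) = ∑ i, ∑ j,
      contract₂ (fun μ ν => extrinsic g t μ ν (ψ y)) (fun μ => tangentField ψ i μ y)
        (fun μ => tangentField ψ j μ y) * sliceCoframe g ψ i μ y * sliceCoframe g ψ j ν y := by
    intro μ ν
    rw [← contract₂_sum_smul (e := fun i μ => tangentField ψ i μ y), ← hp, ← hp,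
      contract₂_extrinsic_projVec hm ht hx]
  have h1 : gaussProj g t μ α β ν (ψ y) = riemannApply g (ψ y) (projVec g t (ψ y) μ)
    (projVec g t (ψ y) α) (projVec g t (ψ y) β) (projVec g t (ψ y) ν) := rfl
  rw [h1, hp, hp, hp, hp, riemannApply_sum_smul (e := fun i μ => tangentField ψ i μ y),
    extrinsic_symm hm ht hx β α, hK μ β, hK α ν, hK μ ν, hK α β]
  simp only [hψ.gauss_tangent hU hg ht hy, sliceRiemann, Finset.sum_mul_sum,
    ← Finset.sum_add_distrib]
  refine Eq.trans ?_ (congrArg (fun z => _ - z) (Finset.sum_congr rfl fun i _ =>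
    Finset.sum_congr rfl fun j _ => Finset.sum_comm))
  simp only [← Finset.sum_sub_distrib]
  exact Finset.sum_congr rfl fun _ _ => Finset.sum_congr rfl fun _ _ =>
    Finset.sum_congr rfl fun _ _ => Finset.sum_congr rfl fun _ _ => by ring

end Gauss

/-! ### The 3+1 expansion of the tidal contraction -/

section Splitting

variable {g : MetricField 4} {t : Coord 4 → ℝ} {U : Set (Coord 4)} {x : Coord 4}

theorem spatialPart_apply (v : Coord 4) (μ : Fin 4) : spatialPart g t x v μ =
    v μ + normal g t μ x * ∑ σ, normalForm g t σ x * v σ := by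
  simp only [spatialPart, proj, add_mul, Finset.sum_add_distrib, ite_mul, one_mul, zero_mul,
    Finset.sum_ite_eq, Finset.mem_univ, if_true, Finset.mul_sum, mul_assoc]

theorem eq_normalPart_add_spatialPart (v : Coord 4) (μ : Fin 4) :
    v μ = normalPart g t x v * normal g t μ x + spatialPart g t x v μ := by
  rw [spatialPart_apply, normalPart]
  ring

theorem normalForm_normal (ht : IsTimeFunctionOn g t U) (hx : x ∈ U) :
    ∑ μ, normalForm g t μ x * normal g t μ x = -1 := by
  simpa only [mul_comm] using normal_unit ht hx

theorem normalForm_spatialPart (ht : IsTimeFunctionOn g t U) (hx : x ∈ U) (v : Coord 4) :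
    ∑ μ, normalForm g t μ x * spatialPart g t x v μ = 0 := by
  simp only [spatialPart_apply, mul_add, Finset.sum_add_distrib, ← mul_assoc, ← Finset.sum_mul,
    normalForm_normal ht hx]
  ring

theorem normalForm_direction (ht : IsTimeFunctionOn g t U) (hx : x ∈ U) (ℓ : Coord 4) :
    ∑ μ, normalForm g t μ x * direction g t x ℓ μ = 0 := by
  have h : ∀ μ, normalForm g t μ x * direction g t x ℓ μ =
      (normalPart g t x ℓ)⁻¹ * (normalForm g t μ x * spatialPart g t x ℓ μ) := fun μ => by
    rw [direction]; ring
  simp only [h, ← Finset.mul_sum, normalForm_spatialPart ht hx, mul_zero]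

theorem eq_normalPart_mul_direction {ℓ : Coord 4} (hS : normalPart g t x ℓ ≠ 0) (μ : Fin 4) :
    ℓ μ = normalPart g t x ℓ * (normal g t μ x + direction g t x ℓ μ) := by
  conv_lhs => rw [eq_normalPart_add_spatialPart (g := g) (t := t) (x := x) ℓ μ]
  rw [direction]
  field_simp

theorem sum_mul_projVec {F : Coord 4} (hF : ∑ μ, normalForm g t μ x * F μ = 0) :
    (fun σ => ∑ μ, F μ * projVec g t x μ σ) = F := by
  funext σ
  have : ∑ μ, F μ * projVec g t x μ σ = spatialPart g t x F σ :=
    Finset.sum_congr rfl fun _ _ => mul_comm _ _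
  rw [this, spatialPart_apply, hF, mul_zero, add_zero]

theorem sum_ricciProj {A B : Coord 4} (hA : ∑ μ, normalForm g t μ x * A μ = 0)
    (hB : ∑ μ, normalForm g t μ x * B μ = 0) :
    ∑ β, ∑ α, ricciProj g t β α x * (A β * B α) =
      riemannApply g x (fun μ => normal g t μ x) B (fun μ => normal g t μ x) A := by
  have h : ∀ β α, ricciProj g t β α x = riemannApply g x (fun ρ => normal g t ρ x)
    (projVec g t x α) (fun ρ => normal g t ρ x) (projVec g t x β) := fun _ _ => rfl
  conv_rhs => rw [← sum_mul_projVec hA, ← sum_mul_projVec hB]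
  simp only [riemannApply_sum₂, riemannApply_sum₄, Finset.mul_sum, h]
  exact Finset.sum_congr rfl fun _ _ => Finset.sum_congr rfl fun _ _ => by ring

theorem sum_codazziProj {A B C : Coord 4} (hA : ∑ μ, normalForm g t μ x * A μ = 0)
    (hB : ∑ μ, normalForm g t μ x * B μ = 0) (hC : ∑ μ, normalForm g t μ x * C μ = 0) :
    ∑ σ, ∑ β, ∑ α, codazziProj g t σ β α x * (A σ * B β * C α) =
      riemannApply g x (fun μ => normal g t μ x) C B A := by
  have h : ∀ σ β α, codazziProj g t σ β α x = riemannApply g x (fun ρ => normal g t ρ x)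
    (projVec g t x α) (projVec g t x β) (projVec g t x σ) := fun _ _ _ => rfl
  conv_rhs => rw [← sum_mul_projVec hA, ← sum_mul_projVec hB, ← sum_mul_projVec hC]
  simp only [riemannApply_sum₂, riemannApply_sum₃, riemannApply_sum₄, Finset.mul_sum, h]
  exact Finset.sum_congr rfl fun _ _ => Finset.sum_congr rfl fun _ _ =>
    Finset.sum_congr rfl fun _ _ => by ring

theorem sum_gaussProj {A B C D : Coord 4} (hA : ∑ μ, normalForm g t μ x * A μ = 0)
    (hB : ∑ μ, normalForm g t μ x * B μ = 0) (hC : ∑ μ, normalForm g t μ x * C μ = 0)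
    (hD : ∑ μ, normalForm g t μ x * D μ = 0) :
    ∑ κ, ∑ α, ∑ β, ∑ σ, gaussProj g t κ α β σ x * A κ * B α * C β * D σ =
      riemannApply g x A B C D := by
  conv_rhs => rw [← sum_mul_projVec hA, ← sum_mul_projVec hB, ← sum_mul_projVec hC,
    ← sum_mul_projVec hD]
  rw [riemannApply_sum_smul]
  rfl

/-- The 3+1 bracket as a combination of curvature contractions with spatial vectors. -/
theorem bracket_eq {V F₁ F₂ : Coord 4} (Φ₁ Φ₂ : ℝ) (hV : ∑ μ, normalForm g t μ x * V μ = 0)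
    (h₁ : ∑ μ, normalForm g t μ x * F₁ μ = 0) (h₂ : ∑ μ, normalForm g t μ x * F₂ μ = 0) :
    bracket g t x V Φ₁ Φ₂ F₁ F₂ =
      (Φ₁ * riemannApply g x (fun μ => normal g t μ x) V (fun μ => normal g t μ x) F₂
        + Φ₂ * riemannApply g x (fun μ => normal g t μ x) V (fun μ => normal g t μ x) F₁
        - Φ₁ * Φ₂ * riemannApply g x (fun μ => normal g t μ x) V (fun μ => normal g t μ x) V
        - riemannApply g x (fun μ => normal g t μ x) F₁ (fun μ => normal g t μ x) F₂)
      + (Φ₁ * riemannApply g x (fun μ => normal g t μ x) V V F₂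
        + Φ₂ * riemannApply g x (fun μ => normal g t μ x) V V F₁
        - riemannApply g x (fun μ => normal g t μ x) F₁ V F₂
        - riemannApply g x (fun μ => normal g t μ x) F₂ V F₁)
      + riemannApply g x F₁ V V F₂ := by
  rw [← sum_ricciProj h₂ hV, ← sum_ricciProj h₁ hV, ← sum_ricciProj hV hV, ← sum_ricciProj h₂ h₁,
    ← sum_codazziProj h₂ hV hV, ← sum_codazziProj h₁ hV hV, ← sum_codazziProj h₂ hV h₁,
    ← sum_codazziProj h₁ hV h₂, ← sum_gaussProj h₁ hV hV h₂, bracket]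
  refine congrArg₂ _ (congrArg₂ _ ?_ ?_) rfl
  · simp only [Finset.mul_sum, ← Finset.sum_add_distrib, ← Finset.sum_sub_distrib]
    exact Finset.sum_congr rfl fun _ _ => Finset.sum_congr rfl fun _ _ => by ring
  · simp only [Finset.mul_sum, ← Finset.sum_add_distrib, ← Finset.sum_sub_distrib]
    exact Finset.sum_congr rfl fun _ _ => Finset.sum_congr rfl fun _ _ =>
      Finset.sum_congr rfl fun _ _ => by ring

/-- The contraction `R(v₁, ℓ, ℓ, v₂)` in terms of the 3+1 splitting of the three vectors. -/
theorem riemannApply_eq_bracket (hg : IsMetricOn g U) (ht : IsTimeFunctionOn g t U) (hx : x ∈ U)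
    {ℓ : Coord 4} (hS : normalPart g t x ℓ ≠ 0) (v₁ v₂ : Coord 4) :
    riemannApply g x v₁ ℓ ℓ v₂ = normalPart g t x ℓ ^ 2 *
      bracket g t x (direction g t x ℓ) (normalPart g t x v₁) (normalPart g t x v₂)
        (spatialPart g t x v₁) (spatialPart g t x v₂) := by
  rw [bracket_eq _ _ (normalForm_direction ht hx ℓ) (normalForm_spatialPart ht hx v₁)
    (normalForm_spatialPart ht hx v₂)]
  have hℓ : ℓ = fun μ => normalPart g t x ℓ * (normal g t μ x + direction g t x ℓ μ) :=
    funext fun μ => eq_normalPart_mul_direction hS μ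
  have hv : ∀ v, v = fun μ => normalPart g t x v * normal g t μ x + spatialPart g t x v μ :=
    fun v => funext fun μ => eq_normalPart_add_spatialPart v μ
  generalize normalPart g t x ℓ = S at *
  generalize direction g t x ℓ = V at *
  have hv₁ := hv v₁
  have hv₂ := hv v₂
  generalize normalPart g t x v₁ = Φ₁ at *
  generalize normalPart g t x v₂ = Φ₂ at *
  generalize spatialPart g t x v₁ = F₁ at *
  generalize spatialPart g t x v₂ = F₂ at *
  rw [hℓ, hv₁, hv₂]
  simp only [riemannApply_add₁ g x (fun μ => Φ₁ * normal g t μ x) F₁,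
    riemannApply_add₄ g x _ _ _ (fun μ => Φ₂ * normal g t μ x) F₂,
    riemannApply_smul₁ g x Φ₁ (fun μ => normal g t μ x),
    riemannApply_smul₄ g x Φ₂ _ _ _ (fun μ => normal g t μ x),
    riemannApply_smul₂ g x S _ (fun μ => normal g t μ x + V μ),
    riemannApply_smul₃ g x S _ _ (fun μ => normal g t μ x + V μ),
    riemannApply_add₂ g x _ (fun μ => normal g t μ x) V,
    riemannApply_add₃ g x _ _ (fun μ => normal g t μ x) V]
  generalize (fun μ => normal g t μ x) = n
  have l := riemannApply_antisymm_last g x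
  have f := fun a b c e => hg.riemannApply_antisymm_first hx a b c e
  have p := fun a b c e => hg.riemannApply_pair_symm hx a b c e
  have z1 : ∀ a b c, riemannApply g x a a b c = 0 := fun a b c => by linarith [f a a b c]
  have z2 : ∀ a b c, riemannApply g x a b c c = 0 := fun a b c => by linarith [l a b c c]
  have e1 : riemannApply g x n V V n = -riemannApply g x n V n V := l _ _ _ _
  have e2 : riemannApply g x F₁ n n F₂ = -riemannApply g x n F₁ n F₂ := f _ _ _ _
  have e3 : riemannApply g x F₁ n V n = riemannApply g x n V n F₁ := by
    rw [f, l, neg_neg, p]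
  have e4 : riemannApply g x F₁ V V n = riemannApply g x n V V F₁ := by
    rw [p, f, l, neg_neg]
  have e5 : riemannApply g x F₁ n V F₂ = -riemannApply g x n F₁ V F₂ := f _ _ _ _
  have e6 : riemannApply g x F₁ V n F₂ = -riemannApply g x n F₂ V F₁ := by
    rw [p, l]
  simp only [z1, z2, e1, e2, e3, e4, e5, e6]
  ring

end Splitting

/-! ### The parallel semi-null frame -/

section Frame

variable {g : MetricField 4} {U : Set (Coord 4)} {I : Set ℝ} {c : ℝ → Coord 4}

theorem hasDerivAt_scalarProd_of_parallel (hg : IsMetricOn g U) {v a b : ℝ → Coord 4} {s : ℝ}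
    (hs : s ∈ I) (hc : c s ∈ U) (hv : ∀ μ, HasDerivAt (fun r => c r μ) (v s μ) s)
    (ha : IsParallelAlong g c v a I) (hb : IsParallelAlong g c v b I) :
    HasDerivAt (fun r => scalarProd g (c r) (a r) (b r)) 0 s := by
  have hgd : ∀ μ ν, HasDerivAt (fun r => g (c r) μ ν)
      (∑ κ, v s κ * pd κ (fun y => g y μ ν) (c s)) s := by
    intro μ ν
    rw [← fderiv_apply_eq_sum_pd]
    exact (hg.differentiableAt hc μ ν).hasFDerivAt.comp_hasDerivAt s (hasDerivAt_pi.2 hv)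
  have h := HasDerivAt.fun_sum (u := Finset.univ) fun μ _ =>
    HasDerivAt.fun_sum (u := Finset.univ) fun ν _ => ((hgd μ ν).mul (ha s hs μ)).mul (hb s hs ν)
  refine h.congr_deriv ?_
  have hcore := hg.sum_pd_metric hc (v s) (a s) (b s)
  have e : ∀ μ ν, ((∑ κ, v s κ * pd κ (fun y => g y μ ν) (c s)) * a s μ
      + g (c s) μ ν * -∑ α, ∑ β, christoffel g μ α β (c s) * v s α * a s β) * b s ν
      + g (c s) μ ν * a s μ * -∑ α, ∑ β, christoffel g ν α β (c s) * v s α * b s β =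
      (∑ κ, v s κ * pd κ (fun y => g y μ ν) (c s)) * a s μ * b s ν
      - (g (c s) μ ν * (∑ α, ∑ β, christoffel g μ α β (c s) * v s α * a s β) * b s ν
      + g (c s) μ ν * a s μ * ∑ α, ∑ β, christoffel g ν α β (c s) * v s α * b s β) :=
    fun μ ν => by ring
  refine (Finset.sum_congr rfl fun μ _ => Finset.sum_congr rfl fun ν _ => e μ ν).trans ?_
  simp only [Finset.sum_sub_distrib, Finset.sum_add_distrib]
  rw [hcore]
  simp only [scalarProd]
  ring

variable {φ : Fin 4 → ℝ → Coord 4} {Q : ℝ} {s₀ : ℝ}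

theorem IsTransportedSNF.scalarProd_eq (hφ : IsTransportedSNF g U I c φ Q s₀)
    (hg : IsMetricOn g U) (hI : IsOpen I) (hIc : I.OrdConnected) (hs₀ : s₀ ∈ I) {s : ℝ}
    (hs : s ∈ I) (a b : Fin 4) :
    scalarProd g (c s) (φ a s) (φ b s) = scalarProd g (c s₀) (φ a s₀) (φ b s₀) := by
  have h : ∀ r ∈ I, HasDerivAt (fun r => scalarProd g (c r) (φ a r) (φ b r)) 0 r := fun r hr =>
    hasDerivAt_scalarProd_of_parallel hg hr (hφ.mapsTo r hr) (hφ.tangent r hr) (hφ.parallel a)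
      (hφ.parallel b)
  exact hI.is_const_of_deriv_eq_zero hIc.isPreconnected
    (fun r hr => (h r hr).differentiableAt.differentiableWithinAt) (fun r hr => (h r hr).deriv)
    hs hs₀

/-- A parallel frame that is semi-null at one point is semi-null everywhere. -/
theorem IsTransportedSNF.isSemiNullFrame (hφ : IsTransportedSNF g U I c φ Q s₀)
    (hg : IsMetricOn g U) (hI : IsOpen I) (hIc : I.OrdConnected) (hs₀ : s₀ ∈ I) {s : ℝ}
    (hs : s ∈ I) : IsSemiNullFrame g (c s) (fun a => φ a s) Q := by
  have h := hφ.scalarProd_eq hg hI hIc hs₀ hs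
  have h0 := hφ.initial
  constructor <;> simp only [h]
  exacts [h0.unit, h0.null, h0.u_dot_ℓ, h0.u_dot, h0.ℓ_dot, h0.orthonormal]

variable {x : Coord 4} {e : Fin 4 → Coord 4}

theorem IsSemiNullFrame.frameMetric_eq (he : IsSemiNullFrame g x e Q) (hg : IsMetricOn g U)
    (hx : x ∈ U) : frameMetric g x e = !![-1, 0, 0, Q; 0, 1, 0, 0; 0, 0, 1, 0; Q, 0, 0, 0] := by
  have hc := hg.scalarProd_comm hx
  ext a b
  fin_cases a <;> fin_cases b <;>
    simp [frameMetric, he.unit, he.null, he.u_dot_ℓ, he.u_dot, he.ℓ_dot, he.orthonormal,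
      hc (e 1) (e 0), hc (e 2) (e 0), hc (e 3) (e 0), hc (e 2) (e 1), hc (e 1) (e 3),
      hc (e 2) (e 3)]

theorem IsSemiNullFrame.frameMetric_mul (he : IsSemiNullFrame g x e Q) (hg : IsMetricOn g U)
    (hx : x ∈ U) (hQ : Q ≠ 0) : frameMetric g x e * snfInverseMetric Q = 1 := by
  rw [he.frameMetric_eq hg hx, snfInverseMetric]
  ext a b
  fin_cases a <;> fin_cases b <;>
    (simp [Matrix.mul_apply, Fin.sum_univ_four]; try field_simp; try simp)

/-- The frame expansion `w^μ = h^{ac} g(φ_c, w) φ_a^μ` of a vector `w`. -/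
theorem IsSemiNullFrame.expansion (he : IsSemiNullFrame g x e Q) (hg : IsMetricOn g U)
    (hx : x ∈ U) (hQ : Q ≠ 0) (w : Coord 4) (μ : Fin 4) :
    ∑ a, (∑ b, snfInverseMetric Q a b * scalarProd g x (e b) w) * e a μ = w μ := by
  let A : Matrix (Fin 4) (Fin 4) ℝ := Matrix.of e
  have hF : frameMetric g x e = A * g x * A.transpose := by
    ext a b
    simp only [frameMetric, Matrix.of_apply, scalarProd, Matrix.mul_apply, Finset.sum_mul,
      Matrix.transpose_apply, A]
    rw [Finset.sum_comm]
    exact Finset.sum_congr rfl fun _ _ => Finset.sum_congr rfl fun _ _ => by ring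
  have h1 : A * (g x * A.transpose * snfInverseMetric Q) = 1 := by
    rw [← he.frameMetric_mul hg hx hQ, hF]
    simp only [Matrix.mul_assoc]
  have h2 := congrArg Matrix.transpose (mul_eq_one_comm.1 h1)
  have hgs : (g x).transpose = g x := by ext a b; exact hg.symm x hx b a
  have hhs : (snfInverseMetric Q).transpose = snfInverseMetric Q := by
    ext a b
    fin_cases a <;> fin_cases b <;> simp [snfInverseMetric]
  simp only [Matrix.transpose_mul, Matrix.transpose_transpose, hgs, hhs, Matrix.transpose_one] at h2
  have h3 : A.transpose.mulVec ((snfInverseMetric Q).mulVec (A.mulVec ((g x).mulVec w))) = w := by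
    rw [Matrix.mulVec_mulVec, Matrix.mulVec_mulVec, Matrix.mulVec_mulVec]
    simp only [Matrix.mul_assoc] at h2 ⊢
    rw [h2, Matrix.one_mulVec]
  have h4 := congrFun h3 μ
  rw [← h4]
  simp only [scalarProd_eq_dotProduct]
  exact Finset.sum_congr rfl fun a _ => mul_comm _ _

/-- The null vector of a semi-null frame is not tangent to the slices. -/
theorem IsSemiNullFrame.normalPart_ne_zero {t : Coord 4 → ℝ} (he : IsSemiNullFrame g x e Q)
    (hU : IsOpen U) (hg : IsLorentzMetricOn g U) (ht : IsTimeFunctionOn g t U) (hx : x ∈ U)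
    (hQ : Q ≠ 0) : normalPart g t x (e 3) ≠ 0 := by
  intro h
  have h0 : e 3 ≠ 0 := by
    intro h0
    apply hQ
    rw [← he.u_dot_ℓ]
    rw [h0]
    simp [scalarProd]
  have := hg.scalarProd_self_pos_of_tangent hU ht hx (neg_eq_zero.1 h) h0
  exact this.ne' he.null

end Frame

end ThreePlusOne

end

/-! ### The optical tidal matrix along the ray -/

theorem mainTheorem2
    (U : Set (ThreePlusOne.Coord 4)) (hU : IsOpen U)
    (g : ThreePlusOne.MetricField 4) (hg : ThreePlusOne.IsLorentzMetricOn g U)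
    (t : ThreePlusOne.Coord 4 → ℝ) (ht : ThreePlusOne.IsTimeFunctionOn g t U)
    (I : Set ℝ) (hI : IsOpen I) (hIc : I.OrdConnected) (s₀ : ℝ) (hs₀ : s₀ ∈ I)
    (c : ℝ → ThreePlusOne.Coord 4) (φ : Fin 4 → ℝ → ThreePlusOne.Coord 4)
    (Q : ℝ) (hQ : Q ≠ 0)
    (hφ : ThreePlusOne.IsTransportedSNF g U I c φ Q s₀) :
    -- along the ray: the frame matrices, the splitting, and the optical tidal matrix
    (∀ s ∈ I,
      -- `h^{ab}` is the inverse of the metric of the frame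
      ThreePlusOne.frameMetric g (c s) (fun a => φ a s) *
          ThreePlusOne.snfInverseMetric Q = 1 ∧
      -- `ℓ^μ = S (n^μ + V^μ)` with `n_μ V^μ = 0`
      (ThreePlusOne.normalPart g t (c s) (φ 3 s) ≠ 0 ∧
        (∀ μ, φ 3 s μ = ThreePlusOne.normalPart g t (c s) (φ 3 s) *
          (ThreePlusOne.normal g t μ (c s) +
            ThreePlusOne.direction g t (c s) (φ 3 s) μ)) ∧
        ∑ μ, ThreePlusOne.normalForm g t μ (c s) *
          ThreePlusOne.direction g t (c s) (φ 3 s) μ = 0) ∧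
      -- `φ_a^μ = Φ_a n^μ + F_a^μ` with `n_μ F_a^μ = 0`
      (∀ a, (∀ μ, φ a s μ =
          ThreePlusOne.normalPart g t (c s) (φ a s) * ThreePlusOne.normal g t μ (c s) +
            ThreePlusOne.spatialPart g t (c s) (φ a s) μ) ∧
        ∑ μ, ThreePlusOne.normalForm g t μ (c s) *
          ThreePlusOne.spatialPart g t (c s) (φ a s) μ = 0) ∧
      -- `R^a_{ℓℓb}` is the matrix in the frame of the operator `R^μ_{αβσ} ℓ^α ℓ^β`
      (∀ b μ, ∑ α, ∑ β, ∑ σ, ThreePlusOne.riemannUp g μ α β σ (c s) *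
          φ 3 s α * φ 3 s β * φ b s σ =
        ∑ a, ThreePlusOne.opticalTidal g (c s) (fun i => φ i s) Q a b * φ a s μ) ∧
      -- the 3+1 form of the optical tidal matrix
      (∀ a b, ThreePlusOne.opticalTidal g (c s) (fun i => φ i s) Q a b =
        ThreePlusOne.normalPart g t (c s) (φ 3 s) ^ 2 *
          ∑ r, ThreePlusOne.snfInverseMetric Q a r *
            ThreePlusOne.bracket g t (c s)
              (ThreePlusOne.direction g t (c s) (φ 3 s))
              (ThreePlusOne.normalPart g t (c s) (φ r s))
              (ThreePlusOne.normalPart g t (c s) (φ b s))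
              (ThreePlusOne.spatialPart g t (c s) (φ r s))
              (ThreePlusOne.spatialPart g t (c s) (φ b s))) ∧
      -- the vanishing components
      (∀ b, ThreePlusOne.opticalTidal g (c s) (fun i => φ i s) Q 0 b = 0) ∧
      (∀ a, ThreePlusOne.opticalTidal g (c s) (fun i => φ i s) Q a 3 = 0)) ∧
    -- the Codazzi and Ricci relations
    (∀ x ∈ U, ∀ μ α β, ThreePlusOne.codazziProj g t μ α β x =
      ThreePlusOne.spatialDerivK g t α μ β x - ThreePlusOne.spatialDerivK g t μ α β x) ∧
    (∀ x ∈ U, ∀ μ ν, ThreePlusOne.ricciProj g t μ ν x =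
      ThreePlusOne.lieNormalK g t μ ν x
        + 1 / ThreePlusOne.lapse g t x * ThreePlusOne.spatialHessLapse g t ν μ x
        + ∑ ρ, ∑ σ, (g x)⁻¹ ρ σ * ThreePlusOne.extrinsic g t σ μ x *
            ThreePlusOne.extrinsic g t ν ρ x) ∧
    -- the Gauss relation, in any coordinates on the slice
    (∀ (W : Set (ThreePlusOne.Coord 3)) (ψ : ThreePlusOne.Coord 3 → ThreePlusOne.Coord 4),
      ThreePlusOne.IsSliceParam t U W ψ → ∀ y ∈ W, ∀ μ α β ν,
        ThreePlusOne.gaussProj g t μ α β ν (ψ y) =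
          ThreePlusOne.sliceRiemann g ψ μ α β ν y
            + ThreePlusOne.extrinsic g t μ β (ψ y) * ThreePlusOne.extrinsic g t α ν (ψ y)
            - ThreePlusOne.extrinsic g t μ ν (ψ y) *
                ThreePlusOne.extrinsic g t β α (ψ y)) := by
  have hm := hg.isMetricOn hU
  refine ⟨fun s hs => ?_, fun x hx μ α β => ThreePlusOne.codazzi_relation hm ht hx μ α β,
    fun x hx μ ν => ThreePlusOne.ricci_relation hm ht hx μ ν,
    fun W ψ hψ y hy μ α β ν => hψ.gauss_relation hU hg ht hy μ α β ν⟩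
  have hx := hφ.mapsTo s hs
  have he := hφ.isSemiNullFrame hm hI hIc hs₀ hs
  have hS := he.normalPart_ne_zero hU hg ht hx hQ
  refine ⟨he.frameMetric_mul hm hx hQ,
    ⟨hS, ThreePlusOne.eq_normalPart_mul_direction hS, ThreePlusOne.normalForm_direction ht hx _⟩,
    fun a => ⟨ThreePlusOne.eq_normalPart_add_spatialPart _,
      ThreePlusOne.normalForm_spatialPart ht hx _⟩,
    fun b μ => ?_, fun a b => ?_, fun b => ?_, fun a => ?_⟩
  · simp only [ThreePlusOne.opticalTidal, ThreePlusOne.riemannApply_eq_scalarProd]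
    rw [he.expansion hm hx hQ]
  · simp only [ThreePlusOne.opticalTidal, Finset.mul_sum]
    refine Finset.sum_congr rfl fun r _ => ?_
    rw [ThreePlusOne.riemannApply_eq_bracket hm ht hx hS]
    ring
  · -- the only nonzero entry of the first row of `h` multiplies `R(ℓ, ℓ, ℓ, φ_b) = 0`
    have h0 := hm.riemannApply_antisymm_first hx (φ 3 s) (φ 3 s) (φ 3 s) (φ b s)
    have h1 : ThreePlusOne.riemannApply g (c s) (φ 3 s) (φ 3 s) (φ 3 s) (φ b s) = 0 := by linarith
    simp [ThreePlusOne.opticalTidal, Fin.sum_univ_four, ThreePlusOne.snfInverseMetric, h1]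
  · -- `R(φ_c, ℓ, ℓ, ℓ) = 0`
    refine Finset.sum_eq_zero fun r _ => ?_
    have h0 := ThreePlusOne.riemannApply_antisymm_last g (c s) (φ r s) (φ 3 s) (φ 3 s) (φ 3 s)
    have h1 : ThreePlusOne.riemannApply g (c s) (φ r s) (φ 3 s) (φ 3 s) (φ 3 s) = 0 := by linarith
    rw [h1, mul_zero]
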